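/- **Theorem (convergence of Batched-NGD for $\beta$-smooth convex functions).** Let $1\le m\le d$ be integers and let $\beta,\varepsilon,D>0$ be real. Let $f:\mathbb R^d\to\mathbb R$ be convex and $\beta$-smooth (differentiable with $\|\nabla f(x)-\nabla f(y)\|\le\beta\|x-y\|$ for all $x,y$, in the Euclidean norm), let $\mathcal D\subseteq\mathbb R^d$ be a closed convex set that contains a minimizer $x^*$ of $f$ over $\mathbb R^d$ (so $\nabla f(x^*)=0$), and let $w_1\in\mathcal D$ with $\|w_1-x^*\|^2\le D$. For real $r$ put $\operatorname{sign}(r)=1$ if $r\ge 0$ and $\operatorname{sign}(r)=-1$ if $r<0$. *Algorithm (Batched-NGD), run for $T$ iterations with parameters $\eta,\gamma$.* The algorithm accesses $f$ only through rounds of queries; in one round it submits at most $m$ pairs $(x,y)$ of points of $\mathbb R^d$ in parallel and receives $\operatorname{sign}(f(x)-f(y))$ for each of them. Put $\mathbf m_1=w_1$. For $t=1,\dots,T$: draw $u_t^1,\dots,u_t^m$ uniformly from the unit sphere of $\mathbb R^d$, all directions of all iterations being independent; query in one round the $m$ pairs $(w_t+\gamma u_t^i,\;w_t-\gamma u_t^i)$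 and receive $o_t^i=\operatorname{sign}\big(f(w_t+\gamma u_t^i)-f(w_t-\gamma u_t^i)\big)$; let $$g_t=\frac1m\sum_{i=1}^m o_t^iu_t^i,\qquad w_{t+1}=\operatorname*{arg\,min}_{w\in\mathcal D}\|w-(w_t-\eta g_t)\|;$$ in a second round query the pair $(\mathbf m_t,w_{t+1})$, and let $\mathbf m_{t+1}=\mathbf m_t$ if $\operatorname{sign}(f(\mathbf m_t)-f(w_{t+1}))<0$ and $\mathbf m_{t+1}=w_{t+1}$ otherwise. Return $\mathbf m_{T+1}$. There is a universal constant $C>0$, not depending on any of the data above, such that, with $$\eta=\frac{m\sqrt\varepsilon}{20\sqrt{d\beta}},\qquad \gamma=\frac{\varepsilon^{3/2}}{960\,\beta\, d\sqrt d\,\max\{D,D^2\}\sqrt{\log 480}}\sqrt{\frac2\beta},\qquad T_\varepsilon=\Big\lfloor C\,\frac{d\beta D}{m\varepsilon}\Big\rfloor$$ (so the denominator of $\gamma$ has $D^2$ whenever $D\ge1$), Batched-NGD run for $T=T_\varepsilon$ iterations returns a point $\mathbf m_{T_\varepsilon+1}$ for which $f(\mathbf m_{T_\varepsilon+1})$ is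 integrable and $$\mathbb E\big[f(\mathbf m_{T_\varepsilon+1})\big]-f(x^*)\le\varepsilon,$$ and it uses exactly $2T_\varepsilon$ rounds of queries, each of at most $m$ pairs. -/

import Mathlib

open MeasureTheory ProbabilityTheory

/-- `f : ℝᵈ → ℝ` is `β`-smooth: it is differentiable and its gradient is `β`-Lipschitz. -/
def IsSmoothFn {d : ℕ} (β : ℝ) (f : EuclideanSpace ℝ (Fin d) → ℝ) : Prop :=
  Differentiable ℝ f ∧ ∀ x y, ‖gradient f x - gradient f y‖ ≤ β * ‖x - y‖

/-- The uniform probability distribution on the unit sphere of `ℝᵈ`, as a measure on `ℝᵈ`: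
the normalized surface measure. -/
noncomputable def uniformSphere (d : ℕ) : Measure (EuclideanSpace ℝ (Fin d)) :=
  ((volume : Measure (EuclideanSpace ℝ (Fin d))).toSphere Set.univ)⁻¹ •
    (volume : Measure (EuclideanSpace ℝ (Fin d))).toSphere.map Subtype.val

open Classical in
/-- The projection `argmin_{p ∈ K} ‖p - z‖`. The value at `z` is only meaningful when the minimum is
attained, as it is for every `z` when `K` is closed and nonempty; it is unique when `K` is
convex. -/
noncomputable def projOnto {d : ℕ} (K : Set (EuclideanSpace ℝ (Fin d)))
    (z : EuclideanSpace ℝ (Fin d)) : EuclideanSpace ℝ (Fin d) :=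
  if h : ∃ p ∈ K, ∀ q ∈ K, ‖p - z‖ ≤ ‖q - z‖ then h.choose else z

/-- The noiseless sign feedback on the duel `(x, y)`: `sign (f x - f y) ∈ {1, -1}`, with the
convention `sign 0 = 1`. -/
noncomputable def signFeedback {E : Type} (f : E → ℝ) (p : E × E) : ℝ :=
  if 0 ≤ f p.1 - f p.2 then 1 else -1

/-- Programs with access to an unknown function only through rounds of batched sign queries.
A program either stops with an output, or plays one round: it submits a batch of `n` pairs of
points in parallel, receives one sign per pair, and goes on depending on the signs. -/
inductive SignProg (E : Type) : Type
  | done (output : E) : SignProg E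
  | query (n : ℕ) (pairs : Fin n → E × E) (next : (Fin n → ℝ) → SignProg E) : SignProg E

namespace SignProg

/-- The output of a program when its queries are answered by the sign feedback of `f`. -/
noncomputable def output {E : Type} (f : E → ℝ) : SignProg E → E
  | done x => x
  | query _ pairs next => output f (next fun i => signFeedback f (pairs i))

/-- The list of the batch sizes of all rounds of queries that a program plays when its queries are
answered by the sign feedback of `f`; its length is the number of rounds of queries. -/
noncomputable def batchSizes {E : Type} (f : E → ℝ) : SignProg E → List ℕ
  | done _ => []
  | query n pairs next => n :: batchSizes f (next fun i => signFeedback f (pairs i))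

end SignProg

/-- Batched normalized gradient descent over the decision set `K` with learning rate `η` and
perturbation parameter `γ`, for the next `T` iterations, from the current point `w` and the current
minimum `b`; the `m` unit directions of the `i`-th of these iterations are `u i 0, …, u i (m-1)`.

One iteration queries the `m` duels `(w + γ uⱼ, w - γ uⱼ)` in one batch, with answers `oⱼ`,
moves to `w' = proj_K (w - η g)` with `g = (1/m) ∑ⱼ oⱼ uⱼ`, and then queries the duel `(b, w')`; the
new current minimum is `b` if the answer is negative and `w'` otherwise. The output is the last
current minimum. -/
noncomputable def batchedNGD {d m : ℕ} (K : Set (EuclideanSpace ℝ (Fin d))) (η γ : ℝ) :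
    (T : ℕ) → (u : ℕ → Fin m → EuclideanSpace ℝ (Fin d)) → (w b : EuclideanSpace ℝ (Fin d)) →
      SignProg (EuclideanSpace ℝ (Fin d))
  | 0, _, _, b => .done b
  | T + 1, u, w, b =>
    .query m (fun j => (w + γ • u 0 j, w - γ • u 0 j)) fun o =>
      let w' := projOnto K (w - η • ((1 / (m : ℝ)) • ∑ j, o j • u 0 j))
      .query 1 (fun _ => (b, w')) fun s =>
        batchedNGD K η γ T (fun i => u (i + 1)) w' (if s 0 < 0 then b else w')

/-- The learning rate `η = m √ε / (20 √(dβ))`. -/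
noncomputable def learningRate (d m : ℕ) (β ε : ℝ) : ℝ :=
  m * √ε / (20 * √(d * β))

/-- The perturbation parameter
`γ = ε^(3/2) / (960 β d √d max(D, D²) √(log 480)) · √(2/β)`; here `max(D, D²) = D²` if `D ≥ 1`. -/
noncomputable def perturbation (d : ℕ) (β D ε : ℝ) : ℝ :=
  ε ^ (3 / 2 : ℝ) / (960 * β * d * √d * max D (D ^ 2) * √(Real.log 480)) * √(2 / β)

/-!
Write `Δ(w) = f w - f z` for the suboptimality, where `z` is the minimizer. One iteration moves
along the average `g` of `m` independent signed directions `o u`. The proof follows the potential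
`‖w - z‖²`, and has four ingredients.

*Drift.* If `o` were the sign of `⟪∇f w, u⟫`, the mean of `o u` would be `n` times
`E|⟪u, n⟫| ≥ 1 / √(3d)`, where `n` is the normalized gradient (`integral_sign_inner_mul`,
`le_integral_abs_inner`). Convexity and smoothness give `⟪n, w - z⟫ ≥ √(2Δ/β)`, because `f` is at
most `f w` on the ball of that radius around `z` (`IsSmoothFn.sqrt_le_inner`). The actual sign can
differ only for `u` in a slab whose width is proportional to `γ`, which has small probability
(`uniformSphere_real_abs_inner_le`). This yields `le_integral_inner_signed`.

*Noise.* Since `m ≤ d`, random directions are nearly orthogonal, so `‖g‖²` has mean and standard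
deviation of order `1 / m` (`integral_norm_batch_sq_le`, `integral_norm_batch_four_le`).

*Squaring the potential.* The best value found is returned and the starting value may exceed `ε` by
any factor, so a bound on the probability of success is not enough. Let `A` be the sum of the
expected decrements `a √Δ` over the iterations so far. Then `‖w - z‖² + A` is almost a
supermartingale, and by `integral_potential_step_le` its second moment grows slowly. After `T`
iterations `A ≥ a T √M` for the best excess value `M`. Hence `a² T² E M` is at most the second
moment, which is `O(D²)` by `integral_output_le` and `potentialBound_le`. As `a² T²` is of order
`D² / ε` times a large constant, `E M` is at most `ε / 2`. Only the excess over the threshold `ε / 2`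
is treated this way, since the error in the drift is controlled only for `Δ > ε / 2`.

*Large `ε`.* If `ε ≥ β D / 2`, already the starting point is good enough by smoothness.
-/

/-! ### The uniform distribution on the sphere -/

open scoped Pointwise ENNReal in
/-- The uniform measure of a set is the proportion of the unit ball taken up by the cone over
that set. -/
theorem uniformSphere_apply {d : ℕ} (hd : 1 ≤ d) {s : Set (EuclideanSpace ℝ (Fin d))}
    (hs : MeasurableSet s) :
    uniformSphere d s =
      volume (Set.Ioo (0 : ℝ) 1 • (Metric.sphere (0 : EuclideanSpace ℝ (Fin d)) 1 ∩ s)) /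
        volume (Metric.ball (0 : EuclideanSpace ℝ (Fin d)) 1) := by
  have hd0 : (d : ℝ≥0∞) ≠ 0 := by simp; omega
  rw [uniformSphere, Measure.smul_apply, Measure.map_apply measurable_subtype_coe hs,
    Measure.toSphere_apply' _ (measurable_subtype_coe hs), Subtype.image_preimage_coe,
    Measure.toSphere_apply_univ, finrank_euclideanSpace_fin, smul_eq_mul, ENNReal.div_eq_inv_mul,
    ENNReal.mul_inv (Or.inl hd0) (Or.inl (by simp)), mul_mul_mul_comm,
    ENNReal.inv_mul_cancel hd0 (by simp), one_mul]

theorem isProbabilityMeasure_uniformSphere {d : ℕ} (hd : 1 ≤ d) :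
    IsProbabilityMeasure (uniformSphere d) := by
  have : Nonempty (Fin d) := ⟨⟨0, hd⟩⟩
  refine ⟨?_⟩
  rw [uniformSphere, Measure.smul_apply, Measure.map_apply measurable_subtype_coe .univ,
    Set.preimage_univ, smul_eq_mul]
  refine ENNReal.inv_mul_cancel ?_ (measure_ne_top _ _)
  simpa using ⟨by omega, (Metric.measure_ball_pos volume _ one_pos).ne'⟩

theorem ae_uniformSphere_norm {d : ℕ} : ∀ᵐ u ∂uniformSphere d, ‖u‖ = 1 := by
  refine Measure.ae_smul_measure ?_ _
  rw [ae_map_iff measurable_subtype_coe.aemeasurable]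
  · exact Filter.Eventually.of_forall fun u => by simp
  · exact (isClosed_eq continuous_norm continuous_const).measurableSet

open scoped Pointwise in
theorem map_uniformSphere {d : ℕ} (hd : 1 ≤ d)
    (L : EuclideanSpace ℝ (Fin d) ≃ₗᵢ[ℝ] EuclideanSpace ℝ (Fin d)) :
    (uniformSphere d).map L = uniformSphere d := by
  ext s hs
  rw [Measure.map_apply L.continuous.measurable hs, uniformSphere_apply hd hs,
    uniformSphere_apply hd (L.continuous.measurable hs)]
  congr 1
  have : Set.Ioo (0 : ℝ) 1 • (Metric.sphere (0 : EuclideanSpace ℝ (Fin d)) 1 ∩ L ⁻¹' s) =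
      L ⁻¹' (Set.Ioo (0 : ℝ) 1 • (Metric.sphere (0 : EuclideanSpace ℝ (Fin d)) 1 ∩ s)) := by
    ext x
    simp only [Set.mem_smul, Set.mem_inter_iff, mem_sphere_zero_iff_norm, Set.mem_preimage]
    constructor
    · rintro ⟨r, hr, y, ⟨hy, hys⟩, rfl⟩
      exact ⟨r, hr, L y, ⟨by simpa using hy, hys⟩, by simp⟩
    · rintro ⟨r, hr, y, ⟨hy, hys⟩, h⟩
      refine ⟨r, hr, L.symm y, ⟨by simpa using hy, by simpa using hys⟩, ?_⟩
      apply L.injective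
      simp [← h]
  rw [this]
  exact L.measurePreserving.measure_preimage_emb L.toHomeomorph.measurableEmbedding _

/-- By rotation invariance, the law of `⟪u, v⟫` depends only on the norm of `v`. -/
theorem integral_inner_uniformSphere_congr {d : ℕ} (hd : 1 ≤ d) (h : ℝ → ℝ)
    {v w : EuclideanSpace ℝ (Fin d)} (hvw : ‖v‖ = ‖w‖) :
    ∫ u, h (inner ℝ u v) ∂uniformSphere d = ∫ u, h (inner ℝ u w) ∂uniformSphere d := by
  set L := (ℝ ∙ (v - w))ᗮ.reflection
  have hL : L v = w := Submodule.reflection_sub hvw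
  conv_rhs => rw [← map_uniformSphere hd L]
  rw [show (L : EuclideanSpace ℝ (Fin d) → EuclideanSpace ℝ (Fin d)) = L.toHomeomorph from rfl,
    L.toHomeomorph.measurableEmbedding.integral_map]
  refine integral_congr_ae (Filter.Eventually.of_forall fun u => ?_)
  have : inner ℝ (L u) w = inner ℝ u v := by rw [← hL]; exact L.inner_map_map u v
  simp only [LinearIsometryEquiv.coe_toHomeomorph, this]

theorem ae_abs_inner_le {d : ℕ} (v : EuclideanSpace ℝ (Fin d)) :
    ∀ᵐ u ∂uniformSphere d, |inner ℝ u v| ≤ ‖v‖ := by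
  filter_upwards [ae_uniformSphere_norm] with u hu
  simpa [hu] using abs_real_inner_le_norm u v

theorem integrable_inner_pow {d : ℕ} (hd : 1 ≤ d) (v : EuclideanSpace ℝ (Fin d)) (k : ℕ) :
    Integrable (fun u => (inner ℝ u v) ^ k) (uniformSphere d) := by
  have := isProbabilityMeasure_uniformSphere hd
  refine Integrable.of_bound (by fun_prop) (‖v‖ ^ k) ?_
  filter_upwards [ae_abs_inner_le v] with u hu
  rw [norm_pow, Real.norm_eq_abs]
  gcongr

theorem integral_inner_sq {d : ℕ} (hd : 1 ≤ d) (v : EuclideanSpace ℝ (Fin d)) :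
    ∫ u, (inner ℝ u v) ^ 2 ∂uniformSphere d = ‖v‖ ^ 2 / d := by
  have := isProbabilityMeasure_uniformSphere hd
  have hd0 : (d : ℝ) ≠ 0 := by positivity
  have key : ∀ i : Fin d, ∫ u, (inner ℝ u (EuclideanSpace.single i ‖v‖)) ^ 2 ∂uniformSphere d =
      ∫ u, (inner ℝ u v) ^ 2 ∂uniformSphere d := fun i =>
    integral_inner_uniformSphere_congr hd (· ^ 2) (by simp)
  have hsum : ∑ i : Fin d, ∫ u, (inner ℝ u (EuclideanSpace.single i ‖v‖)) ^ 2 ∂uniformSphere d =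
      ‖v‖ ^ 2 := by
    rw [← integral_finsetSum _ fun i _ => integrable_inner_pow hd _ 2]
    have : ∀ᵐ u ∂uniformSphere d,
        ∑ i : Fin d, (inner ℝ u (EuclideanSpace.single i ‖v‖)) ^ 2 = ‖v‖ ^ 2 := by
      filter_upwards [ae_uniformSphere_norm] with u hu
      have h1 : ∑ i, u i ^ 2 = 1 := by
        have := EuclideanSpace.real_norm_sq_eq u
        rw [hu] at this; linarith
      simp only [EuclideanSpace.inner_single_right, mul_pow]
      rw [← Finset.mul_sum]; simp [h1]
    rw [integral_congr_ae this]; simp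
  rw [Finset.sum_congr rfl fun i _ => key i] at hsum
  simp at hsum
  field_simp; linarith

theorem integral_inner_four_le {d : ℕ} (hd : 1 ≤ d) (v : EuclideanSpace ℝ (Fin d)) (hv : ‖v‖ = 1) :
    ∫ u, (inner ℝ u v) ^ 4 ∂uniformSphere d ≤ 3 / d ^ 2 := by
  have := isProbabilityMeasure_uniformSphere hd
  have hd0 : (0 : ℝ) < d := by positivity
  set M := ∫ u, (inner ℝ u v) ^ 4 ∂uniformSphere d with hM
  have hM0 : 0 ≤ M := integral_nonneg fun u => by positivity
  have hint : ∀ i j : Fin d, Integrable (fun u : EuclideanSpace ℝ (Fin d) => u i ^ 2 * u j ^ 2)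
      (uniformSphere d) := by
    intro i j
    refine Integrable.of_bound (by fun_prop) 1 ?_
    filter_upwards [ae_uniformSphere_norm] with u hu
    have h (i : Fin d) : |u i| ^ 2 ≤ 1 := by
      have := PiLp.norm_apply_le u i
      rw [hu, Real.norm_eq_abs] at this
      exact pow_le_one₀ (abs_nonneg _) this
    rw [norm_mul, norm_pow, norm_pow, Real.norm_eq_abs, Real.norm_eq_abs]
    exact mul_le_one₀ (h i) (by positivity) (h j)
  have hdiag : ∀ i : Fin d, ∫ u, u i ^ 2 * u i ^ 2 ∂uniformSphere d = M := by
    intro i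
    rw [hM, integral_inner_uniformSphere_congr hd (· ^ 4) (w := EuclideanSpace.single i 1)
      (by simp [hv])]
    refine integral_congr_ae (Filter.Eventually.of_forall fun u => ?_)
    simp only [EuclideanSpace.inner_single_right]
    simp; ring
  -- The vectors `e i ± e j` have the same norm `√2`, which gives the mixed moment.
  have hoff : ∀ i j : Fin d, i ≠ j → ∫ u, u i ^ 2 * u j ^ 2 ∂uniformSphere d = M / 3 := by
    intro i j hij
    have h1 : ∀ s : ℝ, s ^ 2 = 1 →
        ∫ u, (inner ℝ u (EuclideanSpace.single i 1 + EuclideanSpace.single j s :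
          EuclideanSpace ℝ (Fin d))) ^ 4 ∂uniformSphere d = 4 * M := by
      intro s hs
      have hn : ‖(EuclideanSpace.single i 1 + EuclideanSpace.single j s :
          EuclideanSpace ℝ (Fin d))‖ = ‖√2 • v‖ := by
        rw [norm_smul, hv, mul_one, Real.norm_of_nonneg (Real.sqrt_nonneg _)]
        rw [← Real.sqrt_sq (norm_nonneg _)]
        congr 1
        rw [@norm_add_sq_real]
        simp [EuclideanSpace.inner_single_right, hij, hs]
        norm_num
      rw [integral_inner_uniformSphere_congr hd (· ^ 4) hn]
      simp only [inner_smul_right, mul_pow]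
      rw [integral_const_mul]
      congr 1
      have := Real.sq_sqrt (show (0 : ℝ) ≤ 2 by norm_num)
      nlinarith
    have h2 : ∫ u, ((inner ℝ u (EuclideanSpace.single i 1 + EuclideanSpace.single j 1 :
          EuclideanSpace ℝ (Fin d))) ^ 4 + (inner ℝ u (EuclideanSpace.single i 1 +
            EuclideanSpace.single j (-1) : EuclideanSpace ℝ (Fin d))) ^ 4) ∂uniformSphere d =
        ∫ u, (2 * (u i ^ 2 * u i ^ 2) + 12 * (u i ^ 2 * u j ^ 2) + 2 * (u j ^ 2 * u j ^ 2))
          ∂uniformSphere d := by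
      refine integral_congr_ae (Filter.Eventually.of_forall fun u => ?_)
      simp only [inner_add_right, EuclideanSpace.inner_single_right]
      simp; ring
    rw [integral_add (integrable_inner_pow hd _ 4) (integrable_inner_pow hd _ 4),
      h1 1 (by norm_num), h1 (-1) (by norm_num), integral_add, integral_add,
      integral_const_mul, integral_const_mul, integral_const_mul, hdiag, hdiag] at h2
    · linarith
    · exact (hint _ _).const_mul _
    · exact (hint _ _).const_mul _
    · exact ((hint _ _).const_mul _).add ((hint _ _).const_mul _)
    · exact (hint _ _).const_mul _
  have hone : ∑ i : Fin d, ∑ j : Fin d, ∫ u, u i ^ 2 * u j ^ 2 ∂uniformSphere d = 1 := by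
    simp_rw [← integral_finsetSum _ fun j _ => hint _ j]
    rw [← integral_finsetSum _ fun i _ => integrable_finsetSum _ fun j _ => hint i j]
    have : ∀ᵐ u ∂uniformSphere d, ∑ i : Fin d, ∑ j : Fin d, u i ^ 2 * u j ^ 2 = 1 := by
      filter_upwards [ae_uniformSphere_norm] with u hu
      have h1 : ∑ i, u i ^ 2 = 1 := by
        have := EuclideanSpace.real_norm_sq_eq u
        rw [hu] at this; linarith
      rw [← Finset.sum_mul_sum, h1, mul_one]
    rw [integral_congr_ae this]; simp
  have hlow : ∑ i : Fin d, ∑ j : Fin d, M / 3 ≤ 1 := by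
    rw [← hone]
    refine Finset.sum_le_sum fun i _ => Finset.sum_le_sum fun j _ => ?_
    by_cases hij : i = j
    · subst hij; rw [hdiag]; linarith
    · rw [hoff i j hij]
  simp at hlow
  rw [le_div_iff₀ (by positivity)]
  nlinarith

/-- Lower bound for the mean absolute coordinate of a uniform unit vector, from its second and
fourth moments. -/
theorem le_integral_abs_inner {d : ℕ} (hd : 1 ≤ d) (v : EuclideanSpace ℝ (Fin d)) (hv : ‖v‖ = 1) :
    1 / √(3 * d) ≤ ∫ u, |inner ℝ u v| ∂uniformSphere d := by
  have := isProbabilityMeasure_uniformSphere hd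
  have hd0 : (0 : ℝ) < d := by positivity
  set a := √(3 * d) / 2 with ha
  have ha2 : √(3 * d) ^ 2 = 3 * d := Real.sq_sqrt (by positivity)
  have ha0 : 0 < √(3 * d) := by positivity
  -- `1 - z + 4 z³ / 27 = (1 - 2 z / 3)² (1 + z / 3)` is nonnegative for `z = a |x|`.
  have hpt : ∀ x : ℝ, a * x ^ 2 - 4 * a ^ 3 / 27 * x ^ 4 ≤ |x| := by
    intro x
    have h1 : 0 ≤ |x| * ((1 - 2 * (a * |x|) / 3) ^ 2 * (1 + a * |x| / 3)) := by positivity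
    have h2 : |x| ^ 2 = x ^ 2 := sq_abs x
    have h4 : |x| ^ 4 = x ^ 4 := by rw [show (4 : ℕ) = 2 * 2 from rfl, pow_mul, h2, ← pow_mul]
    rw [← h2, ← h4]
    nlinarith
  have hint : Integrable (fun u => |inner ℝ u v|) (uniformSphere d) := by
    simpa using (integrable_inner_pow hd v 1).abs
  calc 1 / √(3 * d) ≤ a * (1 / d) - 4 * a ^ 3 / 27 * (3 / d ^ 2) := by
        rw [ha]
        have h3 : √(3 * d) ^ 3 = √(3 * d) * (3 * d) := by rw [pow_succ, ha2]; ring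
        apply le_of_eq
        rw [div_eq_iff ha0.ne', div_pow, h3]
        have : (d : ℝ) = √(3 * d) ^ 2 / 3 := by rw [ha2]; ring
        field_simp
        rw [ha2]; ring
    _ ≤ a * ∫ u, (inner ℝ u v) ^ 2 ∂uniformSphere d -
        4 * a ^ 3 / 27 * ∫ u, (inner ℝ u v) ^ 4 ∂uniformSphere d := by
        rw [integral_inner_sq hd, hv, one_pow]
        gcongr
        exact integral_inner_four_le hd v hv
    _ = ∫ u, (a * (inner ℝ u v) ^ 2 - 4 * a ^ 3 / 27 * (inner ℝ u v) ^ 4) ∂uniformSphere d := by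
        rw [integral_sub ((integrable_inner_pow hd v 2).const_mul _)
          ((integrable_inner_pow hd v 4).const_mul _), integral_const_mul, integral_const_mul]
    _ ≤ _ := integral_mono (((integrable_inner_pow hd v 2).const_mul _).sub
          ((integrable_inner_pow hd v 4).const_mul _)) hint fun u => hpt _

/-- The slab `|⟪x, v⟫| ≤ δ` of the unit ball has at least `1 / (3 δ d)` disjoint translates in
direction `v` inside the ball of radius `1 + 1 / d`, whose volume is at most `e` times that of the
unit ball. -/
theorem volume_slab_le {d : ℕ} (hd : 1 ≤ d) (v : EuclideanSpace ℝ (Fin d)) (hv : ‖v‖ = 1)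
    {δ : ℝ} (hδ : 0 < δ) :
    volume.real {x : EuclideanSpace ℝ (Fin d) | ‖x‖ < 1 ∧ |inner ℝ x v| ≤ δ} ≤
      3 * Real.exp 1 * d * δ * volume.real (Metric.ball (0 : EuclideanSpace ℝ (Fin d)) 1) := by
  have hd0 : (0 : ℝ) < d := by positivity
  set S := {x : EuclideanSpace ℝ (Fin d) | ‖x‖ < 1 ∧ |inner ℝ x v| ≤ δ} with hS
  have hSm : MeasurableSet S :=
    ((isOpen_lt continuous_norm continuous_const).measurableSet).inter
      ((isClosed_le (by fun_prop : Continuous fun x : EuclideanSpace ℝ (Fin d) => |inner ℝ x v|)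
        continuous_const).measurableSet)
  set N := ⌊1 / (3 * δ * d)⌋₊
  have hNle : (N : ℝ) ≤ 1 / (3 * δ * d) := Nat.floor_le (by positivity)
  have hNlt : 1 / (3 * δ * d) < N + 1 := Nat.lt_floor_add_one _
  let A : ℕ → Set (EuclideanSpace ℝ (Fin d)) := fun k => (fun x => (-(3 * δ * k)) • v + x) ⁻¹' S
  have hAm : ∀ k, MeasurableSet (A k) := fun k => hSm.preimage (by fun_prop)
  have hAv : ∀ k, volume.real (A k) = volume.real S := fun k => by
    simp only [Measure.real, A, measure_preimage_add]
  have hdisj : Set.PairwiseDisjoint (↑(Finset.range (N + 1))) A := by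
    intro i _ j _ hij
    refine Set.disjoint_left.mpr fun x hi hj => hij ?_
    have hi2 := hi.2
    have hj2 := hj.2
    simp only [inner_add_left, inner_smul_left, real_inner_self_eq_norm_sq, hv] at hi2 hj2
    simp only [abs_le] at hi2 hj2
    simp at hi2 hj2
    have h1 : δ * (3 * ((i : ℝ) - j)) ≤ δ * 2 := by nlinarith
    have h2 : δ * (3 * ((j : ℝ) - i)) ≤ δ * 2 := by nlinarith
    have h1' := le_of_mul_le_mul_left h1 hδ
    have h2' := le_of_mul_le_mul_left h2 hδ
    have h3 : (i : ℝ) < j + 1 := by linarith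
    have h4 : (j : ℝ) < i + 1 := by linarith
    norm_cast at h3 h4
    omega
  have hsub : (⋃ k ∈ Finset.range (N + 1), A k) ⊆
      Metric.ball (0 : EuclideanSpace ℝ (Fin d)) (1 + 1 / d) := by
    intro x hx
    simp only [Set.mem_iUnion, Finset.mem_range] at hx
    obtain ⟨k, hk, hx, -⟩ := hx
    have hkN : (k : ℝ) ≤ N := by exact_mod_cast Nat.lt_succ_iff.mp hk
    rw [mem_ball_zero_iff]
    have h1 : x = ((-(3 * δ * k)) • v + x) + (3 * δ * k) • v := by simp
    have h2 : ‖(3 * δ * k) • v‖ ≤ 1 / d := by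
      rw [norm_smul, hv, mul_one, Real.norm_of_nonneg (by positivity)]
      calc 3 * δ * k ≤ 3 * δ * (1 / (3 * δ * d)) := by gcongr; linarith
        _ = 1 / d := by field_simp
    rw [h1]
    exact (norm_add_le _ _).trans_lt (by linarith)
  have hle : (N + 1 : ℝ) * volume.real S ≤
      volume.real (Metric.ball (0 : EuclideanSpace ℝ (Fin d)) (1 + 1 / d)) := by
    have := measureReal_biUnion_finset (μ := volume) hdisj (fun k _ => hAm k)
      (fun k _ => by
        rw [measure_preimage_add]
        exact ((measure_mono (fun x hx => by simpa using hx.1)).trans_lt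
          (measure_ball_lt_top (x := (0 : EuclideanSpace ℝ (Fin d))) (r := 1))).ne)
    simp only [hAv, Finset.sum_const, Finset.card_range, nsmul_eq_mul] at this
    push_cast at this
    rw [← this]
    exact measureReal_mono hsub
  have hball : volume.real (Metric.ball (0 : EuclideanSpace ℝ (Fin d)) (1 + 1 / d)) ≤
      Real.exp 1 * volume.real (Metric.ball (0 : EuclideanSpace ℝ (Fin d)) 1) := by
    rw [Measure.real, Measure.addHaar_ball_of_pos _ _ (by positivity), ENNReal.toReal_mul,
      ENNReal.toReal_ofReal (by positivity), finrank_euclideanSpace_fin]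
    refine mul_le_mul_of_nonneg_right ?_ ENNReal.toReal_nonneg
    calc (1 + 1 / (d : ℝ)) ^ d ≤ (Real.exp (1 / d)) ^ d := by
          gcongr
          linarith [Real.add_one_le_exp (1 / (d : ℝ))]
      _ = Real.exp 1 := by
          rw [← Real.exp_nat_mul]; congr 1; field_simp
  have h1 : 1 / (3 * δ * d) * volume.real S ≤
      Real.exp 1 * volume.real (Metric.ball (0 : EuclideanSpace ℝ (Fin d)) 1) :=
    (mul_le_mul_of_nonneg_right hNlt.le measureReal_nonneg).trans (hle.trans hball)
  calc volume.real S = (3 * δ * d) * (1 / (3 * δ * d) * volume.real S) := by field_simp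
    _ ≤ (3 * δ * d) *
        (Real.exp 1 * volume.real (Metric.ball (0 : EuclideanSpace ℝ (Fin d)) 1)) := by gcongr
    _ = _ := by ring

open scoped Pointwise in
/-- Anti-concentration of one coordinate of a uniform unit vector: the cone over the set lies in a
slab of the unit ball. -/
theorem uniformSphere_real_abs_inner_le {d : ℕ} (hd : 1 ≤ d) (v : EuclideanSpace ℝ (Fin d))
    (hv : ‖v‖ = 1) {δ : ℝ} (hδ : 0 < δ) :
    (uniformSphere d).real {u | |inner ℝ u v| ≤ δ} ≤ 3 * Real.exp 1 * d * δ := by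
  have hm : MeasurableSet {u : EuclideanSpace ℝ (Fin d) | |inner ℝ u v| ≤ δ} :=
    (isClosed_le (by fun_prop) continuous_const).measurableSet
  have hball : 0 < volume.real (Metric.ball (0 : EuclideanSpace ℝ (Fin d)) 1) :=
    ENNReal.toReal_pos (Metric.measure_ball_pos _ _ one_pos).ne' measure_ball_lt_top.ne
  rw [Measure.real, uniformSphere_apply hd hm, ENNReal.toReal_div]
  refine (div_le_iff₀ hball).mpr (le_trans ?_ (volume_slab_le hd v hv hδ))
  refine measureReal_mono ?_ ((measure_mono (fun x hx => by simpa using hx.1)).trans_lt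
          (measure_ball_lt_top (x := (0 : EuclideanSpace ℝ (Fin d))) (r := 1))).ne
  rintro x ⟨r, hr, y, ⟨hy, hys⟩, rfl⟩
  rw [mem_sphere_zero_iff_norm] at hy
  have hys : |inner ℝ y v| ≤ δ := hys
  simp only [Set.mem_ofPred_eq, norm_smul, inner_smul_left, hy, mul_one, abs_mul]
  simp only [conj_trivial, Real.norm_eq_abs, abs_of_pos hr.1]
  exact ⟨hr.2, (mul_le_of_le_one_left (abs_nonneg _) hr.2.le).trans hys⟩

/-! ### Smooth convex functions -/

/-- Quadratic upper and lower bounds for a smooth function around a point. -/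
theorem IsSmoothFn.abs_sub_le {d : ℕ} {β : ℝ} {f : EuclideanSpace ℝ (Fin d) → ℝ}
    (hf : IsSmoothFn β f) (x h : EuclideanSpace ℝ (Fin d)) :
    |f (x + h) - f x - inner ℝ (gradient f x) h| ≤ β / 2 * ‖h‖ ^ 2 := by
  set g : ℝ → ℝ := fun t => f (x + t • h) - f x - t * inner ℝ (gradient f x) h with hg
  have hline : ∀ t : ℝ, HasDerivAt (fun s : ℝ => x + s • h) h t := fun t => by
    simpa using ((hasDerivAt_id t).smul_const h).const_add x
  have hder : ∀ t : ℝ, HasDerivAt g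
      (inner ℝ (gradient f (x + t • h)) h - inner ℝ (gradient f x) h) t := by
    intro t
    have h1 := (hf.1 (x + t • h)).hasFDerivAt.comp_hasDerivAt t (hline t)
    rw [← inner_gradient_left] at h1
    have h2 := (h1.sub_const (f x)).sub ((hasDerivAt_id t).mul_const (inner ℝ (gradient f x) h))
    exact h2.congr_deriv (by simp)
  have hbd : ∀ t : ℝ, 0 ≤ t →
      ‖inner ℝ (gradient f (x + t • h)) h - inner ℝ (gradient f x) h‖ ≤ β * ‖h‖ ^ 2 * t := by
    intro t ht
    rw [← inner_sub_left]
    calc ‖inner ℝ (gradient f (x + t • h) - gradient f x) h‖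
        ≤ ‖gradient f (x + t • h) - gradient f x‖ * ‖h‖ := norm_inner_le_norm _ _
      _ ≤ (β * ‖(x + t • h) - x‖) * ‖h‖ := by gcongr; exact hf.2 _ _
      _ = β * ‖h‖ ^ 2 * t := by
          rw [add_sub_cancel_left, norm_smul, Real.norm_of_nonneg ht]; ring
  have hB : ∀ t : ℝ, HasDerivAt (fun s : ℝ => β * ‖h‖ ^ 2 * s ^ 2 / 2) (β * ‖h‖ ^ 2 * t) t := by
    intro t
    have := (((hasDerivAt_id t).pow 2).const_mul (β * ‖h‖ ^ 2)).div_const 2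
    refine this.congr_deriv ?_
    simp; ring
  have := image_norm_le_of_norm_deriv_right_le_deriv_boundary (a := 0) (b := 1) (f := g)
    (fun t _ => (hder t).continuousAt.continuousWithinAt) (fun t _ => (hder t).hasDerivWithinAt)
    (B := fun s : ℝ => β * ‖h‖ ^ 2 * s ^ 2 / 2) (by simp [hg]) hB
    (fun t ht => hbd t ht.1) (x := 1) (by simp)
  simp only [hg, one_smul, one_mul, Real.norm_eq_abs] at this
  linarith

theorem ConvexOn.add_inner_gradient_le {d : ℕ} {f : EuclideanSpace ℝ (Fin d) → ℝ}
    (hc : ConvexOn ℝ Set.univ f) (hf : Differentiable ℝ f) (x y : EuclideanSpace ℝ (Fin d)) :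
    f x + inner ℝ (gradient f x) (y - x) ≤ f y := by
  have hline : HasDerivAt (fun s : ℝ => x + s • (y - x)) (y - x) 0 := by
    simpa using ((hasDerivAt_id (0 : ℝ)).smul_const (y - x)).const_add x
  have h1 : HasDerivAt (fun s : ℝ => f (x + s • (y - x))) (inner ℝ (gradient f x) (y - x)) 0 := by
    have hx : HasFDerivAt f (fderiv ℝ f x) (x + (0 : ℝ) • (y - x)) := by
      simpa using (hf x).hasFDerivAt
    have := hx.comp_hasDerivAt (0 : ℝ) hline
    rwa [inner_gradient_left]
  have hconv : ConvexOn ℝ Set.univ (fun s : ℝ => f (x + s • (y - x))) := by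
    have := hc.comp_affineMap (AffineMap.lineMap x y : ℝ →ᵃ[ℝ] EuclideanSpace ℝ (Fin d))
    refine ⟨convex_univ, fun a _ b _ s t hs ht hst => ?_⟩
    have := this.2 (Set.mem_univ a) (Set.mem_univ b) hs ht hst
    simpa [AffineMap.lineMap_apply, add_comm] using this
  have := hconv.le_slope_of_hasDerivAt (Set.mem_univ 0) (Set.mem_univ 1) one_pos h1
  simp only [slope_def_field, one_smul, zero_smul, add_zero, add_sub_cancel, sub_zero,
    div_one] at this
  linarith

section Minimizer

variable {d : ℕ} {β : ℝ} {f : EuclideanSpace ℝ (Fin d) → ℝ} {z : EuclideanSpace ℝ (Fin d)}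

theorem gradient_eq_zero_of_forall_le (hz : ∀ x, f z ≤ f x) : gradient f z = 0 := by
  have : IsLocalMin f z := Filter.Eventually.of_forall hz
  rw [gradient, this.fderiv_eq_zero, map_zero]

theorem IsSmoothFn.sub_le_of_forall_le (hf : IsSmoothFn β f) (hz : ∀ x, f z ≤ f x)
    (x : EuclideanSpace ℝ (Fin d)) : f x - f z ≤ β / 2 * ‖x - z‖ ^ 2 := by
  have := (abs_le.mp (hf.abs_sub_le z (x - z))).2
  simpa [gradient_eq_zero_of_forall_le hz] using this

theorem sub_le_norm_gradient_mul (hc : ConvexOn ℝ Set.univ f) (hf : Differentiable ℝ f)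
    (x : EuclideanSpace ℝ (Fin d)) : f x - f z ≤ ‖gradient f x‖ * ‖x - z‖ := by
  have h1 := hc.add_inner_gradient_le hf x z
  have h2 := real_inner_le_norm (gradient f x) (x - z)
  rw [← neg_sub x z, inner_neg_right] at h1
  linarith

/-- At a point with value `f z + Δ`, the whole ball of radius `√(2Δ/β)` around the minimizer `z`
lies on the non-positive side of the tangent hyperplane. -/
theorem IsSmoothFn.sqrt_le_inner (hβ : 0 < β) (hc : ConvexOn ℝ Set.univ f) (hf : IsSmoothFn β f)
    (hz : ∀ x, f z ≤ f x) {x v : EuclideanSpace ℝ (Fin d)} (hv : ‖v‖ = 1)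
    (hxv : gradient f x = ‖gradient f x‖ • v) (hx : 0 < ‖gradient f x‖) :
    √(2 * (f x - f z) / β) ≤ inner ℝ v (x - z) := by
  set r := √(2 * (f x - f z) / β) with hr
  have hr2 : r ^ 2 = 2 * (f x - f z) / β :=
    Real.sq_sqrt (div_nonneg (by linarith [hz x]) hβ.le)
  have h1 := hf.sub_le_of_forall_le hz (z + r • v)
  have h2 : ‖z + r • v - z‖ ^ 2 = r ^ 2 := by
    rw [add_sub_cancel_left, norm_smul, hv, mul_one, Real.norm_eq_abs, sq_abs]
  have h3 : β / 2 * r ^ 2 = f x - f z := by rw [hr2]; field_simp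
  have h4 := hc.add_inner_gradient_le hf.1 x (z + r • v)
  rw [h2, h3] at h1
  have h5 : inner ℝ (gradient f x) (z + r • v - x) =
      ‖gradient f x‖ * (r - inner ℝ v (x - z)) := by
    rw [hxv, inner_smul_left, show z + r • v - x = r • v - (x - z) by abel, inner_sub_right,
      inner_smul_right, real_inner_self_eq_norm_sq, hv, norm_smul, norm_norm, hv]
    simp
  have h6 : ‖gradient f x‖ * (r - inner ℝ v (x - z)) ≤ 0 := by rw [← h5]; linarith
  by_contra hcon
  push Not at hcon
  have := mul_pos hx (sub_pos.mpr hcon)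
  linarith

end Minimizer

/-! ### Projection onto a closed convex set -/

section Projection

variable {d : ℕ} {K : Set (EuclideanSpace ℝ (Fin d))}

theorem projOnto_spec (hK : IsClosed K) (hne : K.Nonempty) (z : EuclideanSpace ℝ (Fin d)) :
    projOnto K z ∈ K ∧ ∀ q ∈ K, ‖projOnto K z - z‖ ≤ ‖q - z‖ := by
  have h : ∃ p ∈ K, ∀ q ∈ K, ‖p - z‖ ≤ ‖q - z‖ := by
    obtain ⟨p, hp, hpz⟩ := hK.exists_infDist_eq_dist hne z
    refine ⟨p, hp, fun q hq => ?_⟩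
    rw [← dist_eq_norm, ← dist_eq_norm, dist_comm p, dist_comm q, ← hpz]
    exact Metric.infDist_le_dist_of_mem hq
  rw [projOnto, dif_pos h]
  exact h.choose_spec

theorem inner_projOnto_le (hK : IsClosed K) (hc : Convex ℝ K) (z : EuclideanSpace ℝ (Fin d))
    {q : EuclideanSpace ℝ (Fin d)} (hq : q ∈ K) :
    inner ℝ (z - projOnto K z) (q - projOnto K z) ≤ 0 := by
  obtain ⟨h1, h2⟩ := projOnto_spec hK ⟨q, hq⟩ z
  refine (norm_eq_iInf_iff_real_inner_le_zero hc h1).mp ?_ q hq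
  have : Nonempty K := ⟨⟨q, hq⟩⟩
  refine le_antisymm (le_ciInf fun w => ?_)
    (ciInf_le ⟨0, by rintro _ ⟨w, rfl⟩; positivity⟩ (⟨_, h1⟩ : K))
  rw [norm_sub_rev, norm_sub_rev z]
  exact h2 w w.2

theorem norm_projOnto_sub_projOnto_le (hK : IsClosed K) (hc : Convex ℝ K) (hne : K.Nonempty)
    (x y : EuclideanSpace ℝ (Fin d)) : ‖projOnto K x - projOnto K y‖ ≤ ‖x - y‖ := by
  have h1 := inner_projOnto_le hK hc x (projOnto_spec hK hne y).1
  have h2 := inner_projOnto_le hK hc y (projOnto_spec hK hne x).1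
  set p := projOnto K x
  set q := projOnto K y
  have h3 : inner ℝ (x - y) (p - q) - ‖p - q‖ ^ 2 =
      -(inner ℝ (x - p) (q - p) + inner ℝ (y - q) (p - q)) := by
    rw [← real_inner_self_eq_norm_sq, ← inner_sub_left, ← neg_sub p q, inner_neg_right,
      neg_add_eq_sub, ← inner_sub_left, ← inner_neg_left]
    congr 1; abel
  have h4 := real_inner_le_norm (x - y) (p - q)
  by_contra hcon
  push Not at hcon
  nlinarith [norm_nonneg (x - y), norm_nonneg (p - q)]

theorem projOnto_eq_self {x : EuclideanSpace ℝ (Fin d)} (hK : IsClosed K) (hx : x ∈ K) :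
    projOnto K x = x := by
  have := (projOnto_spec hK ⟨x, hx⟩ x).2 x hx
  simpa [sub_eq_zero] using this

theorem continuous_projOnto (hK : IsClosed K) (hc : Convex ℝ K) (hne : K.Nonempty) :
    Continuous (projOnto K) :=
  (LipschitzWith.of_dist_le_mul (K := 1) fun x y => by
    simpa [dist_eq_norm] using norm_projOnto_sub_projOnto_le hK hc hne x y).continuous

theorem norm_projOnto_sub_le (hK : IsClosed K) (hc : Convex ℝ K) {x : EuclideanSpace ℝ (Fin d)}
    (hx : x ∈ K) (z : EuclideanSpace ℝ (Fin d)) : ‖projOnto K z - x‖ ≤ ‖z - x‖ := by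
  simpa [projOnto_eq_self hK hx] using norm_projOnto_sub_projOnto_le hK hc ⟨x, hx⟩ z x

end Projection

/-! ### Moments of a batch of signed directions -/

/-- Averaging over all but the first of `k + 1` independent samples first. -/
theorem integral_pi_succ {E : Type*} [MeasurableSpace E] (σ : Measure E) [IsProbabilityMeasure σ]
    {k : ℕ} {F : (Fin (k + 1) → E) → ℝ} (hF : Integrable F (Measure.pi fun _ => σ)) :
    Integrable (fun x => ∫ u, F (Fin.cons x u) ∂Measure.pi fun _ : Fin k => σ) σ ∧
    ∫ u, F u ∂(Measure.pi fun _ => σ) =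
      ∫ x, ∫ u, F (Fin.cons x u) ∂(Measure.pi fun _ : Fin k => σ) ∂σ := by
  have hmp := (measurePreserving_piFinSuccAbove (fun _ : Fin (k + 1) => σ) 0).symm
  have hint := (hmp.integrable_comp_emb (MeasurableEquiv.measurableEmbedding _)).mpr hF
  refine ⟨hint.integral_prod_left.congr (Filter.Eventually.of_forall fun x => ?_), ?_⟩
  · simp [MeasurableEquiv.piFinSuccAbove_symm_apply]
    rfl
  · rw [← hmp.integral_comp' F]
    have := integral_prod _ hint
    simp only [Function.comp_def] at this
    rw [this]
    simp [MeasurableEquiv.piFinSuccAbove_symm_apply]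
    rfl

section Batch

variable {d : ℕ} {o : EuclideanSpace ℝ (Fin d) → ℝ}

theorem ae_pi_norm (hd : 1 ≤ d) (k : ℕ) :
    ∀ᵐ u ∂Measure.pi fun _ : Fin k => uniformSphere d, ∀ j, ‖u j‖ = 1 := by
  have := isProbabilityMeasure_uniformSphere hd
  rw [ae_all_iff]
  intro j
  exact (measurePreserving_eval (fun _ : Fin k => uniformSphere d) j).quasiMeasurePreserving.ae
    ae_uniformSphere_norm

theorem integral_signed_inner_sq (hd : 1 ≤ d) (ho : ∀ u, o u ^ 2 = 1)
    (s : EuclideanSpace ℝ (Fin d)) :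
    ∫ u, (inner ℝ (o u • u) s) ^ 2 ∂uniformSphere d = ‖s‖ ^ 2 / d := by
  rw [← integral_inner_sq hd]
  simp [inner_smul_left, mul_pow, ho]

theorem integrable_signed_inner (hd : 1 ≤ d) (hom : Measurable o) (ho : ∀ u, o u ^ 2 = 1)
    (s : EuclideanSpace ℝ (Fin d)) (k : ℕ) :
    Integrable (fun u => (inner ℝ (o u • u) s) ^ k) (uniformSphere d) := by
  have := isProbabilityMeasure_uniformSphere hd
  refine Integrable.of_bound (by fun_prop) (‖s‖ ^ k) ?_
  filter_upwards [ae_abs_inner_le s] with u hu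
  have : |o u| = 1 := by rw [← sq_eq_sq₀ (abs_nonneg _) zero_le_one]; simp [ho]
  rw [norm_pow, Real.norm_eq_abs, inner_smul_left, abs_mul]
  simp only [conj_trivial, this, one_mul]
  gcongr

theorem two_mul_integral_signed_inner_le (hd : 1 ≤ d) (hom : Measurable o) (ho : ∀ u, o u ^ 2 = 1)
    (s : EuclideanSpace ℝ (Fin d)) :
    2 * ∫ u, inner ℝ (o u • u) s ∂uniformSphere d ≤ ‖s‖ ^ 2 / d + 1 := by
  have := isProbabilityMeasure_uniformSphere hd
  rw [← integral_signed_inner_sq hd ho, ← integral_const_mul]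
  have h1 : ∫ _u : EuclideanSpace ℝ (Fin d), (1 : ℝ) ∂uniformSphere d = 1 := by simp
  have h2 := integrable_signed_inner hd hom ho s 2
  have h3 : Integrable (fun u => inner ℝ (o u • u) s) (uniformSphere d) := by
    simpa using integrable_signed_inner hd hom ho s 1
  rw [← h1, ← integral_add h2 (integrable_const _)]
  exact integral_mono (h3.const_mul _) (h2.add (integrable_const _)) fun u => by
    dsimp only
    nlinarith [sq_nonneg (inner ℝ (o u • u) s - 1)]

theorem norm_add_signed_sq (ho : ∀ u, o u ^ 2 = 1) (s : EuclideanSpace ℝ (Fin d))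
    {u : EuclideanSpace ℝ (Fin d)} (hu : ‖u‖ = 1) :
    ‖s + o u • u‖ ^ 2 = ‖s‖ ^ 2 + 1 + 2 * inner ℝ (o u • u) s := by
  rw [norm_add_sq_real, norm_smul, hu, mul_one, Real.norm_eq_abs, sq_abs, ho, real_inner_comm]
  ring

theorem integral_norm_add_signed_sq_le (hd : 1 ≤ d) (hom : Measurable o) (ho : ∀ u, o u ^ 2 = 1)
    (s : EuclideanSpace ℝ (Fin d)) :
    ∫ u, ‖s + o u • u‖ ^ 2 ∂uniformSphere d ≤ (1 + 1 / d) * ‖s‖ ^ 2 + 2 := by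
  have := isProbabilityMeasure_uniformSphere hd
  have h3 : Integrable (fun u => inner ℝ (o u • u) s) (uniformSphere d) := by
    simpa using integrable_signed_inner hd hom ho s 1
  have h : ∀ᵐ u ∂uniformSphere d,
      ‖s + o u • u‖ ^ 2 = ‖s‖ ^ 2 + 1 + 2 * inner ℝ (o u • u) s := by
    filter_upwards [ae_uniformSphere_norm] with u hu using norm_add_signed_sq ho s hu
  rw [integral_congr_ae h, integral_add (integrable_const _) (h3.const_mul _), integral_const_mul]
  have := two_mul_integral_signed_inner_le hd hom ho s
  simp only [integral_const, probReal_univ, smul_eq_mul, one_mul]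
  rw [show (1 + 1 / (d : ℝ)) * ‖s‖ ^ 2 = ‖s‖ ^ 2 + ‖s‖ ^ 2 / d by ring]
  linarith

theorem integral_norm_add_signed_four_le (hd : 1 ≤ d) (hom : Measurable o)
    (ho : ∀ u, o u ^ 2 = 1) (s : EuclideanSpace ℝ (Fin d)) :
    ∫ u, ‖s + o u • u‖ ^ 4 ∂uniformSphere d ≤
      (1 + 1 / d) ^ 2 * ‖s‖ ^ 4 + 10 * ‖s‖ ^ 2 + 3 := by
  have := isProbabilityMeasure_uniformSphere hd
  have hd1 : 1 / (d : ℝ) ≤ 1 := by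
    rw [div_le_one (by positivity)]; exact_mod_cast hd
  have h2 := integrable_signed_inner hd hom ho s 2
  have h3 : Integrable (fun u => inner ℝ (o u • u) s) (uniformSphere d) := by
    simpa using integrable_signed_inner hd hom ho s 1
  set N := ‖s‖ ^ 2 with hN
  have hN0 : 0 ≤ N := by positivity
  have h : ∀ᵐ u ∂uniformSphere d, ‖s + o u • u‖ ^ 4 =
      (N + 1) ^ 2 + 4 * (N + 1) * inner ℝ (o u • u) s + 4 * (inner ℝ (o u • u) s) ^ 2 := by
    filter_upwards [ae_uniformSphere_norm] with u hu
    rw [show (4 : ℕ) = 2 * 2 from rfl, pow_mul, norm_add_signed_sq ho s hu]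
    ring
  have h1 : Integrable (fun u => (N + 1) ^ 2 + 4 * (N + 1) * inner ℝ (o u • u) s)
      (uniformSphere d) := (integrable_const _).add (h3.const_mul _)
  rw [integral_congr_ae h, integral_add h1 (h2.const_mul _),
    integral_add (integrable_const _) (h3.const_mul _), integral_const_mul,
    integral_const_mul, integral_signed_inner_sq hd ho]
  have h4 := two_mul_integral_signed_inner_le hd hom ho s
  simp only [integral_const, probReal_univ, smul_eq_mul, one_mul]
  have h5 : (N + 1) * (2 * ∫ u, inner ℝ (o u • u) s ∂uniformSphere d) ≤ (N + 1) * (N / d + 1) :=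
    mul_le_mul_of_nonneg_left h4 (by positivity)
  have h6 : ‖s‖ ^ 4 = N ^ 2 := by rw [hN]; ring
  have h7 : N * (1 / d) ≤ N * 1 := mul_le_mul_of_nonneg_left hd1 hN0
  have h8 : 0 ≤ (1 / (d : ℝ)) ^ 2 * N ^ 2 := by positivity
  rw [h6, ← hN]
  have h9 : N / (d : ℝ) = N * (1 / d) := by ring
  rw [h9] at h5 ⊢
  nlinarith

theorem norm_add_sum_signed_le (ho : ∀ u, o u ^ 2 = 1) (s : EuclideanSpace ℝ (Fin d)) {k : ℕ}
    {u : Fin k → EuclideanSpace ℝ (Fin d)} (hu : ∀ j, ‖u j‖ = 1) :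
    ‖s + ∑ j, o (u j) • u j‖ ≤ ‖s‖ + k := by
  refine (norm_add_le _ _).trans (add_le_add le_rfl ((norm_sum_le _ _).trans ?_))
  refine (Finset.sum_le_sum (g := fun _ => (1 : ℝ)) fun j _ => ?_).trans (by simp)
  have : |o (u j)| = 1 := by rw [← sq_eq_sq₀ (abs_nonneg _) zero_le_one]; simp [ho]
  rw [norm_smul, hu, mul_one, Real.norm_eq_abs, this]

theorem integrable_norm_add_sum_signed (hd : 1 ≤ d) (hom : Measurable o) (ho : ∀ u, o u ^ 2 = 1)
    (k : ℕ) (s : EuclideanSpace ℝ (Fin d)) (p : ℕ) :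
    Integrable (fun u : Fin k → EuclideanSpace ℝ (Fin d) => ‖s + ∑ j, o (u j) • u j‖ ^ p)
      (Measure.pi fun _ => uniformSphere d) := by
  have := isProbabilityMeasure_uniformSphere hd
  refine Integrable.of_bound (by fun_prop) ((‖s‖ + k) ^ p) ?_
  filter_upwards [ae_pi_norm hd k] with u hu
  rw [norm_pow, norm_norm]
  gcongr
  exact norm_add_sum_signed_le ho s hu

theorem integrable_norm_add_signed (hd : 1 ≤ d) (hom : Measurable o) (ho : ∀ u, o u ^ 2 = 1)
    (s : EuclideanSpace ℝ (Fin d)) (p : ℕ) :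
    Integrable (fun u => ‖s + o u • u‖ ^ p) (uniformSphere d) := by
  have := isProbabilityMeasure_uniformSphere hd
  refine Integrable.of_bound (by fun_prop) ((‖s‖ + 1) ^ p) ?_
  filter_upwards [ae_uniformSphere_norm] with u hu
  rw [norm_pow, norm_norm]
  gcongr
  simpa using norm_add_sum_signed_le ho s (k := 1) (u := fun _ => u) fun _ => hu

/-- Appending one signed direction multiplies the bound by at most `1 + 1 / d` and adds a
constant: its mean has norm at most `1 / √d`, whatever the signs are. -/
theorem integral_norm_add_sum_signed_sq_le (hd : 1 ≤ d) (hom : Measurable o)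
    (ho : ∀ u, o u ^ 2 = 1) (k : ℕ) : ∀ s : EuclideanSpace ℝ (Fin d),
    ∫ u : Fin k → EuclideanSpace ℝ (Fin d), ‖s + ∑ j, o (u j) • u j‖ ^ 2
      ∂(Measure.pi fun _ => uniformSphere d) ≤ (1 + 1 / d) ^ k * (‖s‖ ^ 2 + 2 * k) := by
  have := isProbabilityMeasure_uniformSphere hd
  induction k with
  | zero => intro s; simp
  | succ k ih =>
    intro s
    have hq : 1 ≤ (1 + 1 / (d : ℝ)) := by simp
    obtain ⟨hi, he⟩ := integral_pi_succ _ (integrable_norm_add_sum_signed hd hom ho (k + 1) s 2)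
    rw [he]
    simp only [Fin.sum_univ_succ, Fin.cons_zero, Fin.cons_succ, ← add_assoc] at hi ⊢
    have hs := integrable_norm_add_signed hd hom ho s 2
    calc _ ≤ ∫ x, (1 + 1 / (d : ℝ)) ^ k * (‖s + o x • x‖ ^ 2 + 2 * k) ∂uniformSphere d :=
          integral_mono hi ((hs.add (integrable_const _)).const_mul _) fun x => ih _
      _ = (1 + 1 / (d : ℝ)) ^ k * (∫ x, ‖s + o x • x‖ ^ 2 ∂uniformSphere d + 2 * k) := by
          rw [integral_const_mul, integral_add hs (integrable_const _)]; simp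
      _ ≤ (1 + 1 / (d : ℝ)) ^ k * (((1 + 1 / d) * ‖s‖ ^ 2 + 2) + 2 * k) := by
          gcongr; exact integral_norm_add_signed_sq_le hd hom ho s
      _ ≤ (1 + 1 / (d : ℝ)) ^ k * ((1 + 1 / d) * (‖s‖ ^ 2 + 2 * (k + 1 : ℕ))) := by
          gcongr
          push_cast
          nlinarith [mul_nonneg (sub_nonneg.mpr hq) (by positivity : (0 : ℝ) ≤ 2 * (k + 1))]
      _ = _ := by rw [pow_succ]; ring

theorem integral_norm_add_sum_signed_four_le (hd : 1 ≤ d) (hom : Measurable o)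
    (ho : ∀ u, o u ^ 2 = 1) (k : ℕ) : ∀ s : EuclideanSpace ℝ (Fin d),
    ∫ u : Fin k → EuclideanSpace ℝ (Fin d), ‖s + ∑ j, o (u j) • u j‖ ^ 4
      ∂(Measure.pi fun _ => uniformSphere d) ≤
        ((1 + 1 / d) ^ 2) ^ k * (‖s‖ ^ 4 + 10 * k * ‖s‖ ^ 2 + 10 * k ^ 2) := by
  have := isProbabilityMeasure_uniformSphere hd
  induction k with
  | zero => intro s; simp
  | succ k ih =>
    intro s
    have hq : 0 ≤ 1 / (d : ℝ) := by positivity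
    obtain ⟨hi, he⟩ := integral_pi_succ _ (integrable_norm_add_sum_signed hd hom ho (k + 1) s 4)
    rw [he]
    simp only [Fin.sum_univ_succ, Fin.cons_zero, Fin.cons_succ, ← add_assoc] at hi ⊢
    have hs2 := integrable_norm_add_signed hd hom ho s 2
    have hs4 := integrable_norm_add_signed hd hom ho s 4
    calc _ ≤ ∫ x, ((1 + 1 / (d : ℝ)) ^ 2) ^ k *
            (‖s + o x • x‖ ^ 4 + 10 * k * ‖s + o x • x‖ ^ 2 + 10 * k ^ 2) ∂uniformSphere d :=
          integral_mono hi
            (((hs4.add (hs2.const_mul _)).add (integrable_const _)).const_mul _) fun x => ih _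
      _ = ((1 + 1 / (d : ℝ)) ^ 2) ^ k * (∫ x, ‖s + o x • x‖ ^ 4 ∂uniformSphere d +
            10 * k * ∫ x, ‖s + o x • x‖ ^ 2 ∂uniformSphere d + 10 * k ^ 2) := by
          have h1 : Integrable (fun x => ‖s + o x • x‖ ^ 4 + 10 * k * ‖s + o x • x‖ ^ 2)
            (uniformSphere d) := hs4.add (hs2.const_mul _)
          rw [integral_const_mul, integral_add h1 (integrable_const _),
            integral_add hs4 (hs2.const_mul _), integral_const_mul]
          simp
      _ ≤ ((1 + 1 / (d : ℝ)) ^ 2) ^ k * (((1 + 1 / d) ^ 2 * ‖s‖ ^ 4 + 10 * ‖s‖ ^ 2 + 3) +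
            10 * k * ((1 + 1 / d) * ‖s‖ ^ 2 + 2) + 10 * k ^ 2) := by
          gcongr
          · exact integral_norm_add_signed_four_le hd hom ho s
          · exact integral_norm_add_signed_sq_le hd hom ho s
      _ ≤ ((1 + 1 / (d : ℝ)) ^ 2) ^ k * ((1 + 1 / d) ^ 2 *
            (‖s‖ ^ 4 + 10 * (k + 1 : ℕ) * ‖s‖ ^ 2 + 10 * (k + 1 : ℕ) ^ 2)) := by
          gcongr
          push_cast
          generalize 1 / (d : ℝ) = q at hq
          have h1 : 0 ≤ q * ((k + 1) * ‖s‖ ^ 2) := by positivity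
          have h2 : 0 ≤ q ^ 2 * ((k + 1) * ‖s‖ ^ 2) := by positivity
          have h3 : 0 ≤ q * ((k : ℝ) + 1) ^ 2 := by positivity
          have h4 : 0 ≤ q ^ 2 * ((k : ℝ) + 1) ^ 2 := by positivity
          have h5 : 0 ≤ q * ‖s‖ ^ 2 := by positivity
          nlinarith
      _ = _ := by rw [pow_succ]; ring

theorem one_add_one_div_pow_le {m d : ℕ} (hm : m ≤ d) (hd : 1 ≤ d) :
    (1 + 1 / (d : ℝ)) ^ m ≤ 2.72 := by
  calc (1 + 1 / (d : ℝ)) ^ m ≤ (1 + 1 / (d : ℝ)) ^ d := pow_le_pow_right₀ (by simp) hm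
    _ ≤ (Real.exp (1 / d)) ^ d := by
        gcongr
        linarith [Real.add_one_le_exp (1 / (d : ℝ))]
    _ = Real.exp 1 := by
        rw [← Real.exp_nat_mul]; congr 1; field_simp
    _ ≤ 2.72 := by linarith [Real.exp_one_lt_d9]

/-- A batch of at most `d` signed directions behaves like a sum of orthogonal vectors up to
constants. -/
theorem integral_norm_batch_sq_le {m : ℕ} (hm1 : 1 ≤ m) (hm : m ≤ d) (hom : Measurable o)
    (ho : ∀ u, o u ^ 2 = 1) :
    ∫ u : Fin m → EuclideanSpace ℝ (Fin d), ‖(1 / (m : ℝ)) • ∑ j, o (u j) • u j‖ ^ 2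
      ∂(Measure.pi fun _ => uniformSphere d) ≤ 6 / m := by
  have h := integral_norm_add_sum_signed_sq_le (hm1.trans hm) hom ho m 0
  have hm0 : (0 : ℝ) < m := by positivity
  simp only [zero_add, norm_zero] at h
  simp only [norm_smul, mul_pow, integral_const_mul]
  have h2 := one_add_one_div_pow_le hm (hm1.trans hm)
  have h3 : (1 + 1 / (d : ℝ)) ^ m * (0 ^ 2 + 2 * m) ≤ 6 * m := by nlinarith
  rw [norm_div, norm_one, Real.norm_of_nonneg hm0.le]
  calc _ ≤ (1 / (m : ℝ)) ^ 2 * (6 * m) := by gcongr; exact h.trans h3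
    _ = 6 / m := by field_simp

/-- The fourth moment bound that makes the squared step length, and not only its mean, of order
`1 / m`. -/
theorem integral_norm_batch_four_le {m : ℕ} (hm1 : 1 ≤ m) (hm : m ≤ d) (hom : Measurable o)
    (ho : ∀ u, o u ^ 2 = 1) :
    ∫ u : Fin m → EuclideanSpace ℝ (Fin d), ‖(1 / (m : ℝ)) • ∑ j, o (u j) • u j‖ ^ 4
      ∂(Measure.pi fun _ => uniformSphere d) ≤ 75 / m ^ 2 := by
  have h := integral_norm_add_sum_signed_four_le (hm1.trans hm) hom ho m 0
  have hm0 : (0 : ℝ) < m := by positivity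
  simp only [zero_add, norm_zero] at h
  simp only [norm_smul, mul_pow, integral_const_mul]
  have h2 : ((1 + 1 / (d : ℝ)) ^ 2) ^ m ≤ 7.5 := by
    rw [← pow_mul, mul_comm, pow_mul]
    calc _ ≤ (2.72 : ℝ) ^ 2 := by gcongr; exact one_add_one_div_pow_le hm (hm1.trans hm)
      _ ≤ 7.5 := by norm_num
  have h3 : ((1 + 1 / (d : ℝ)) ^ 2) ^ m * (0 ^ 4 + 10 * m * 0 ^ 2 + 10 * m ^ 2) ≤ 75 * m ^ 2 := by
    have : (0 : ℝ) ≤ m ^ 2 := by positivity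
    nlinarith
  rw [norm_div, norm_one, Real.norm_of_nonneg hm0.le]
  calc _ ≤ (1 / (m : ℝ)) ^ 4 * (75 * m ^ 2) := by gcongr; exact h.trans h3
    _ = 75 / m ^ 2 := by field_simp

end Batch

/-! ### Expected progress of one iteration -/

theorem signFeedback_sq {E : Type} (f : E → ℝ) (p : E × E) : signFeedback f p ^ 2 = 1 := by
  unfold signFeedback; split <;> norm_num

section Drift

variable {d : ℕ}

/-- The reflection in the axis `v` preserves `⟪u, v⟫` and the uniform measure and flips the
components of `u` orthogonal to `v`, so these do not contribute. -/
theorem integral_sign_inner_mul (hd : 1 ≤ d) (v x : EuclideanSpace ℝ (Fin d)) (hv : ‖v‖ = 1) :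
    ∫ u, (if 0 ≤ inner ℝ u v then 1 else -1) * inner ℝ u x ∂uniformSphere d =
      inner ℝ v x * ∫ u, |inner ℝ u v| ∂uniformSphere d := by
  have := isProbabilityMeasure_uniformSphere hd
  set h : EuclideanSpace ℝ (Fin d) → ℝ := fun u =>
    (if 0 ≤ inner ℝ u v then 1 else -1) * inner ℝ u x with hh
  set L := (ℝ ∙ v).reflection
  have hL : ∀ u, L u = (2 * inner ℝ u v) • v - u := fun u => by
    rw [Submodule.reflection_apply, Submodule.starProjection_unit_singleton ℝ hv, two_smul,
      ← add_smul, two_mul, real_inner_comm]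
  have hm : Measurable fun u : EuclideanSpace ℝ (Fin d) =>
      (if 0 ≤ inner ℝ u v then (1 : ℝ) else -1) :=
    Measurable.ite (measurableSet_le measurable_const (by fun_prop)) measurable_const
      measurable_const
  have hint : Integrable h (uniformSphere d) := by
    refine Integrable.of_bound (hm.mul (by fun_prop)).aestronglyMeasurable ‖x‖ ?_
    filter_upwards [ae_abs_inner_le x] with u hu
    rw [hh, norm_mul]
    split <;> simpa using hu
  have hinv : ∫ u, h (L u) ∂uniformSphere d = ∫ u, h u ∂uniformSphere d := by
    conv_rhs => rw [← map_uniformSphere hd L]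
    rw [show (L : EuclideanSpace ℝ (Fin d) → EuclideanSpace ℝ (Fin d)) = L.toHomeomorph from rfl,
      L.toHomeomorph.measurableEmbedding.integral_map]
  have hintL : Integrable (fun u => h (L u)) (uniformSphere d) := by
    have h1 := hint
    rw [← map_uniformSphere hd L, show (L : EuclideanSpace ℝ (Fin d) → EuclideanSpace ℝ (Fin d)) =
      L.toHomeomorph from rfl, L.toHomeomorph.measurableEmbedding.integrable_map_iff] at h1
    exact h1
  have hsum : ∀ u, h u + h (L u) = 2 * inner ℝ v x * |inner ℝ u v| := by
    intro u
    have h1 : inner ℝ (L u) v = inner ℝ u v := by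
      rw [hL, inner_sub_left, inner_smul_left, real_inner_self_eq_norm_sq, hv]
      simp; ring
    have h2 : inner ℝ (L u) x = 2 * inner ℝ u v * inner ℝ v x - inner ℝ u x := by
      rw [hL, inner_sub_left, inner_smul_left]; simp
    simp only [hh, h1, h2]
    split_ifs with h0
    · rw [abs_of_nonneg h0]; ring
    · rw [abs_of_neg (not_le.mp h0)]; ring
  have := integral_add hint hintL
  rw [hinv] at this
  simp only [hsum, integral_const_mul] at this
  linarith

/-- A mean signed direction points away from the minimizer. The error term accounts for the signs
that are wrong because `f` is only approximately linear on the scale `γ`; these occur in a slab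
around the hyperplane orthogonal to the gradient. -/
theorem le_integral_inner_signed {β γ : ℝ} {f : EuclideanSpace ℝ (Fin d) → ℝ}
    {z w : EuclideanSpace ℝ (Fin d)} (hd : 1 ≤ d) (hβ : 0 < β) (hγ : 0 < γ)
    (hc : ConvexOn ℝ Set.univ f) (hf : IsSmoothFn β f) (hz : ∀ x, f z ≤ f x) (hw : f z < f w) :
    √(2 * (f w - f z) / β) / √(3 * d) -
        3 * Real.exp 1 * d * β * γ * ‖w - z‖ ^ 2 / (f w - f z) ≤
      ∫ u, inner ℝ (signFeedback f (w + γ • u, w - γ • u) • u) (w - z) ∂uniformSphere d := by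
  have := isProbabilityMeasure_uniformSphere hd
  have hΔ : 0 < f w - f z := sub_pos.mpr hw
  have hGR := sub_le_norm_gradient_mul hc hf.1 w (z := z)
  set G := ‖gradient f w‖ with hG
  set R := ‖w - z‖ with hR
  have hG0 : 0 < G := by
    by_contra h
    have : G = 0 := le_antisymm (not_lt.mp h) (norm_nonneg _)
    rw [this, zero_mul] at hGR
    linarith
  have hR0 : 0 ≤ R := norm_nonneg _
  set v := G⁻¹ • gradient f w with hv_def
  have hv : ‖v‖ = 1 := by
    rw [hv_def, norm_smul, norm_inv, norm_norm, ← hG, inv_mul_cancel₀ hG0.ne']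
  have hGv : gradient f w = G • v := by
    rw [hv_def, smul_smul, mul_inv_cancel₀ hG0.ne', one_smul]
  set δ := β * γ / (2 * G) with hδ
  have hδ0 : 0 < δ := by positivity
  set B := {u : EuclideanSpace ℝ (Fin d) | |inner ℝ u v| ≤ δ} with hB
  have hBm : MeasurableSet B := (isClosed_le (by fun_prop) continuous_const).measurableSet
  have hcont : Continuous f := hf.1.continuous
  have hom : Measurable fun u => signFeedback f (w + γ • u, w - γ • u) :=
    Measurable.ite (measurableSet_le measurable_const (by fun_prop)) measurable_const
      measurable_const
  have hi1 : Integrable (fun u => inner ℝ (signFeedback f (w + γ • u, w - γ • u) • u) (w - z))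
      (uniformSphere d) := by
    simpa using integrable_signed_inner hd hom (fun _ => signFeedback_sq _ _) (w - z) 1
  have hi2 : Integrable (fun u => (if 0 ≤ inner ℝ u v then 1 else -1) * inner ℝ u (w - z))
      (uniformSphere d) := by
    have hm : Measurable fun u : EuclideanSpace ℝ (Fin d) =>
        (if 0 ≤ inner ℝ u v then (1 : ℝ) else -1) :=
      Measurable.ite (measurableSet_le measurable_const (by fun_prop)) measurable_const
        measurable_const
    have := integrable_signed_inner hd hm (fun u => by split <;> norm_num) (w - z) 1
    simpa only [inner_smul_left, pow_one, conj_trivial] using this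
  have hi3 : Integrable (B.indicator fun _ => 2 * R) (uniformSphere d) :=
    (integrable_const _).indicator hBm
  have hpt : ∀ᵐ u ∂uniformSphere d,
      (if 0 ≤ inner ℝ u v then 1 else -1) * inner ℝ u (w - z) - B.indicator (fun _ => 2 * R) u ≤
        inner ℝ (signFeedback f (w + γ • u, w - γ • u) • u) (w - z) := by
    filter_upwards [ae_uniformSphere_norm, ae_abs_inner_le (w - z)] with u hu hux
    rw [inner_smul_left, conj_trivial]
    obtain ⟨hux1, hux2⟩ := abs_le.mp hux
    rw [← hR] at hux1 hux2
    by_cases huB : u ∈ B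
    · rw [Set.indicator_of_mem huB]
      unfold signFeedback
      split_ifs <;> linarith
    · -- Off the slab `B` the linear part of `f (w + γ u) - f (w - γ u)` decides the sign.
      rw [Set.indicator_of_notMem huB, sub_zero]
      have h1 := hf.abs_sub_le w (γ • u)
      have h2 := hf.abs_sub_le w (-(γ • u))
      rw [norm_neg, inner_neg_right, ← sub_eq_add_neg] at h2
      rw [norm_smul, hu, mul_one, Real.norm_of_nonneg hγ.le, inner_smul_right, hGv,
        inner_smul_left, conj_trivial, real_inner_comm] at h1 h2
      obtain ⟨h1a, h1b⟩ := abs_le.mp h1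
      obtain ⟨h2a, h2b⟩ := abs_le.mp h2
      have h3 : δ < |inner ℝ u v| := not_le.mp huB
      have h4 : β * γ ^ 2 = γ * (2 * G) * δ := by rw [hδ]; field_simp
      have h5 : 0 < γ * (2 * G) := by positivity
      apply le_of_eq
      congr 1
      unfold signFeedback
      dsimp only
      split_ifs with ha hb hb
      · rfl
      · exfalso
        rw [abs_of_nonneg ha] at h3
        have := mul_lt_mul_of_pos_left h3 h5
        linarith
      · exfalso
        rw [abs_of_neg (not_le.mp ha)] at h3
        have := mul_lt_mul_of_pos_left h3 h5
        linarith
      · rfl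
  have hmono := integral_mono_ae (hi2.sub hi3) hi1 hpt
  rw [integral_sub' hi2 hi3, integral_sign_inner_mul hd v (w - z) hv,
    integral_indicator_const _ hBm, smul_eq_mul] at hmono
  refine le_trans ?_ hmono
  have hα := hf.sqrt_le_inner hβ hc hz hv hGv (hG ▸ hG0)
  have h1 : √(2 * (f w - f z) / β) / √(3 * d) ≤
      inner ℝ v (w - z) * ∫ u, |inner ℝ u v| ∂uniformSphere d := by
    rw [div_eq_mul_one_div]
    exact mul_le_mul hα (le_integral_abs_inner hd v hv) (by positivity)
      ((Real.sqrt_nonneg _).trans hα)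
  have h2 := uniformSphere_real_abs_inner_le hd v hv hδ0
  have h3 : (uniformSphere d).real B * (2 * R) ≤
      3 * Real.exp 1 * d * β * γ * R ^ 2 / (f w - f z) := by
    calc (uniformSphere d).real B * (2 * R) ≤ 3 * Real.exp 1 * d * δ * (2 * R) := by gcongr
      _ = 3 * Real.exp 1 * d * β * γ * R * (1 / G) := by rw [hδ]; field_simp
      _ ≤ 3 * Real.exp 1 * d * β * γ * R * (R / (f w - f z)) := by
          refine mul_le_mul_of_nonneg_left ?_ (by positivity)
          rw [div_le_div_iff₀ hG0 hΔ]
          linarith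
      _ = _ := by ring
  linarith

/-- One iteration in terms of the potential `Q = ‖w - z‖² + A`, where `A` accumulates the
decrements `δ` expected in each iteration. The potential may increase only by lower order terms,
both in mean and in mean square. -/
theorem integral_potential_step_le {m : ℕ} {K : Set (EuclideanSpace ℝ (Fin d))}
    {o : EuclideanSpace ℝ (Fin d) → ℝ} {w z : EuclideanSpace ℝ (Fin d)} {η δ ρ A : ℝ}
    (hm1 : 1 ≤ m) (hm : m ≤ d) (hK : IsClosed K) (hKc : Convex ℝ K) (hzK : z ∈ K)
    (hom : Measurable o) (ho : ∀ u, o u ^ 2 = 1) (hA : 0 ≤ A) (hδ0 : 0 ≤ δ)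
    (hρ : 0 ≤ ρ)
    (hδ : δ ≤ 2 * η * ∫ u, inner ℝ (o u • u) (w - z) ∂uniformSphere d + ρ * ‖w - z‖ ^ 2)
    (hδ2 : δ ^ 2 ≤ 4 / 3 * (η ^ 2 * (‖w - z‖ ^ 2 / d))) :
    let Q := ‖w - z‖ ^ 2 + A
    let Q' : (Fin m → EuclideanSpace ℝ (Fin d)) → ℝ := fun u =>
      ‖projOnto K (w - η • ((1 / (m : ℝ)) • ∑ j, o (u j) • u j)) - z‖ ^ 2 + (A + δ)
    let π : Measure (Fin m → EuclideanSpace ℝ (Fin d)) := Measure.pi fun _ => uniformSphere d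
    Integrable Q' π ∧ Integrable (fun u => Q' u ^ 2) π ∧
      ∫ u, Q' u ∂π ≤ (1 + ρ) * Q + 6 * (η ^ 2 / m) ∧
      ∫ u, Q' u ^ 2 ∂π ≤ (1 + ρ) ^ 2 * Q ^ 2 + 34 * (η ^ 2 / m) * Q + 150 * (η ^ 2 / m) ^ 2 := by
  intro Q Q' π
  have hd : 1 ≤ d := hm1.trans hm
  have := isProbabilityMeasure_uniformSphere hd
  have hm0 : (0 : ℝ) < m := by positivity
  have hd0 : (0 : ℝ) < d := by positivity
  have hmd : (m : ℝ) ≤ d := by exact_mod_cast hm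
  set φ := ‖w - z‖ ^ 2 with hφ
  have hφ0 : 0 ≤ φ := by positivity
  have hQ0 : 0 ≤ Q := by positivity
  let g : (Fin m → EuclideanSpace ℝ (Fin d)) → EuclideanSpace ℝ (Fin d) := fun u =>
    (1 / (m : ℝ)) • ∑ j, o (u j) • u j
  have hgm : Measurable g := by fun_prop
  have hgn : ∀ᵐ u ∂π, ‖g u‖ ≤ 1 := by
    filter_upwards [ae_pi_norm hd m] with u hu
    have := norm_add_sum_signed_le ho 0 hu
    simp only [zero_add, norm_zero] at this
    rw [norm_smul, Real.norm_of_nonneg (by positivity), one_div, inv_mul_le_iff₀ hm0]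
    linarith
  set ξ : (Fin m → EuclideanSpace ℝ (Fin d)) → ℝ := fun u => inner ℝ (g u) (w - z) with hξ
  have hξm : Measurable ξ := by fun_prop
  have hξn : ∀ᵐ u ∂π, |ξ u| ≤ ‖w - z‖ := by
    filter_upwards [hgn] with u hu
    exact (abs_real_inner_le_norm _ _).trans (mul_le_of_le_one_left (norm_nonneg _) hu)
  have hiξ : Integrable ξ π := Integrable.of_bound hξm.aestronglyMeasurable _ hξn
  have hiξ2 : Integrable (fun u => ξ u ^ 2) π := by
    refine Integrable.of_bound (hξm.pow_const 2).aestronglyMeasurable (‖w - z‖ ^ 2) ?_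
    filter_upwards [hξn] with u hu
    rw [norm_pow, Real.norm_eq_abs]
    gcongr
  have hig : ∀ k : ℕ, Integrable (fun u => ‖g u‖ ^ k) π := by
    intro k
    refine Integrable.of_bound (hgm.norm.pow_const k).aestronglyMeasurable 1 ?_
    filter_upwards [hgn] with u hu
    rw [norm_pow, norm_norm]
    exact pow_le_one₀ (norm_nonneg _) hu
  have hξsum : ∀ u, ξ u = (1 / (m : ℝ)) * ∑ j, inner ℝ (o (u j) • u j) (w - z) := fun u => by
    simp only [hξ, g, inner_smul_left, sum_inner, conj_trivial]
  have heval : ∀ (k : ℕ) (j : Fin m), Integrable (fun u : Fin m → EuclideanSpace ℝ (Fin d) =>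
        (inner ℝ (o (u j) • u j) (w - z)) ^ k) π ∧
      ∫ u, (inner ℝ (o (u j) • u j) (w - z)) ^ k ∂π =
        ∫ u, (inner ℝ (o u • u) (w - z)) ^ k ∂uniformSphere d := by
    intro k j
    have h1 := integrable_signed_inner hd hom ho (w - z) k
    have hmp := measurePreserving_eval (fun _ : Fin m => uniformSphere d) j
    refine ⟨hmp.integrable_comp_of_integrable h1, ?_⟩
    exact integral_comp_eval (μ := fun _ : Fin m => uniformSphere d) (i := j)
      h1.aestronglyMeasurable
  have hEξ : ∫ u, ξ u ∂π = ∫ u, inner ℝ (o u • u) (w - z) ∂uniformSphere d := by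
    have h1 := fun j => heval 1 j
    simp only [pow_one] at h1
    simp only [hξsum]
    rw [integral_const_mul, integral_finsetSum _ fun j _ => (h1 j).1,
      Finset.sum_congr rfl fun j _ => (h1 j).2]
    simp
    field_simp
  have hEξ2 : ∫ u, ξ u ^ 2 ∂π ≤ φ / d := by
    have h1 := fun j => heval 2 j
    have h2 : ∀ u, ξ u ^ 2 ≤ (1 / (m : ℝ)) * ∑ j, (inner ℝ (o (u j) • u j) (w - z)) ^ 2 := by
      intro u
      have h3 := sq_sum_le_card_mul_sum_sq (s := Finset.univ)
        (f := fun j => inner ℝ (o (u j) • u j) (w - z))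
      rw [hξsum, mul_pow]
      simp only [Finset.card_univ, Fintype.card_fin] at h3
      calc _ ≤ (1 / (m : ℝ)) ^ 2 * (m * ∑ j, (inner ℝ (o (u j) • u j) (w - z)) ^ 2) := by gcongr
        _ = _ := by field_simp
    refine (integral_mono hiξ2
      ((integrable_finsetSum _ fun j _ => (h1 j).1).const_mul _) h2).trans (le_of_eq ?_)
    rw [integral_const_mul, integral_finsetSum _ fun j _ => (h1 j).1,
      Finset.sum_congr rfl fun j _ => ((h1 j).2.trans (integral_signed_inner_sq hd ho (w - z)))]
    simp
    rw [← hφ]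
    field_simp
  have hQ'0 : ∀ u, 0 ≤ Q' u := fun u => by positivity
  have hQ'm : Measurable Q' :=
    (((continuous_projOnto hK hKc ⟨z, hzK⟩).measurable.comp
      (hgm.const_smul η |>.const_sub w)).sub_const z).norm.pow_const 2 |>.add_const _
  have hQ'Y : ∀ u, Q' u ≤ Q + (δ - 2 * η * ξ u + η ^ 2 * ‖g u‖ ^ 2) := by
    intro u
    have h1 := norm_projOnto_sub_le hK hKc hzK (w - η • g u)
    have h2 : ‖w - η • g u - z‖ ^ 2 = φ - 2 * η * ξ u + η ^ 2 * ‖g u‖ ^ 2 := by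
      rw [show w - η • g u - z = (w - z) - η • g u by abel, norm_sub_sq_real, inner_smul_right,
        norm_smul, mul_pow, Real.norm_eq_abs, sq_abs, real_inner_comm]
      ring
    have h3 : ‖projOnto K (w - η • g u) - z‖ ^ 2 ≤ ‖w - η • g u - z‖ ^ 2 := by gcongr
    rw [h2] at h3
    change ‖projOnto K (w - η • g u) - z‖ ^ 2 + (A + δ) ≤ φ + A + _
    linarith
  -- Only upper bounds for `Q'` are squared, so nonnegativity of `Q'` is needed here.
  have hQ'Y2 : ∀ u, Q' u ^ 2 ≤ Q ^ 2 + 2 * Q * (δ - 2 * η * ξ u + η ^ 2 * ‖g u‖ ^ 2) +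
      (4 * δ ^ 2 + 16 * η ^ 2 * ξ u ^ 2 + 2 * η ^ 4 * ‖g u‖ ^ 4) := by
    intro u
    have h1 : Q' u ^ 2 ≤ (Q + (δ - 2 * η * ξ u + η ^ 2 * ‖g u‖ ^ 2)) ^ 2 :=
      pow_le_pow_left₀ (hQ'0 u) (hQ'Y u) 2
    nlinarith [sq_nonneg (δ - 2 * η * ξ u - η ^ 2 * ‖g u‖ ^ 2), sq_nonneg (δ + 2 * η * ξ u)]
  have hiY : Integrable (fun u => Q + (δ - 2 * η * ξ u + η ^ 2 * ‖g u‖ ^ 2)) π :=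
    (integrable_const _).add (((integrable_const _).sub (hiξ.const_mul _)).add
      ((hig 2).const_mul _))
  have hiX : Integrable (fun u => δ - 2 * η * ξ u + η ^ 2 * ‖g u‖ ^ 2) π :=
    ((integrable_const _).sub (hiξ.const_mul _)).add ((hig 2).const_mul _)
  have hiX1 : Integrable (fun u => δ - 2 * η * ξ u) π :=
    (integrable_const _).sub (hiξ.const_mul _)
  have hiZ1 : Integrable (fun u => 4 * δ ^ 2 + 16 * η ^ 2 * ξ u ^ 2) π :=
    (integrable_const _).add (hiξ2.const_mul _)
  have hiZ : Integrable
      (fun u => 4 * δ ^ 2 + 16 * η ^ 2 * ξ u ^ 2 + 2 * η ^ 4 * ‖g u‖ ^ 4) π :=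
    hiZ1.add ((hig 4).const_mul _)
  have hiW : Integrable
      (fun u => Q ^ 2 + 2 * Q * (δ - 2 * η * ξ u + η ^ 2 * ‖g u‖ ^ 2)) π :=
    (integrable_const _).add (hiX.const_mul _)
  have hiQ' : Integrable Q' π := hiY.mono' hQ'm.aestronglyMeasurable
    (Filter.Eventually.of_forall fun u => by
      rw [Real.norm_of_nonneg (hQ'0 u)]; exact hQ'Y u)
  have hiQ'2 : Integrable (fun u => Q' u ^ 2) π :=
    (hiW.add hiZ).mono' (hQ'm.pow_const 2).aestronglyMeasurable
    (Filter.Eventually.of_forall fun u => by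
      rw [Real.norm_of_nonneg (by positivity)]; exact hQ'Y2 u)
  have hEX : ∫ u, (δ - 2 * η * ξ u + η ^ 2 * ‖g u‖ ^ 2) ∂π ≤ ρ * Q + 6 * (η ^ 2 / m) := by
    rw [integral_add hiX1 ((hig 2).const_mul _), integral_sub (integrable_const _)
      (hiξ.const_mul _), integral_const_mul, integral_const_mul, hEξ]
    have h1 := integral_norm_batch_sq_le hm1 hm hom ho
    have h2 : η ^ 2 * ∫ u, ‖g u‖ ^ 2 ∂π ≤ η ^ 2 * (6 / m) := by gcongr
    have h3 : ρ * φ ≤ ρ * Q := by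
      gcongr
      exact le_add_of_nonneg_right hA
    have h4 : η ^ 2 * (6 / m) = 6 * (η ^ 2 / m) := by ring
    simp only [integral_const, probReal_univ, smul_eq_mul, one_mul]
    linarith
  refine ⟨hiQ', hiQ'2, ?_, ?_⟩
  · refine (integral_mono hiQ' hiY hQ'Y).trans ?_
    rw [integral_add (integrable_const _) hiX]
    simp only [integral_const, probReal_univ, smul_eq_mul, one_mul]
    linarith
  · refine (integral_mono hiQ'2 (hiW.add hiZ) hQ'Y2).trans ?_
    rw [integral_add' hiW hiZ, integral_add (integrable_const _) (hiX.const_mul _),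
      integral_add hiZ1 ((hig 4).const_mul _), integral_add (integrable_const _)
      (hiξ2.const_mul _)]
    simp only [integral_const_mul]
    simp only [integral_const, probReal_univ, smul_eq_mul, one_mul]
    have h1 : 2 * Q * ∫ u, (δ - 2 * η * ξ u + η ^ 2 * ‖g u‖ ^ 2) ∂π ≤
        2 * Q * (ρ * Q + 6 * (η ^ 2 / m)) := by gcongr
    have h2 : 16 * η ^ 2 * ∫ u, ξ u ^ 2 ∂π ≤ 16 * η ^ 2 * (φ / d) := by gcongr
    have h3 : 2 * η ^ 4 * ∫ u, ‖g u‖ ^ 4 ∂π ≤ 2 * η ^ 4 * (75 / m ^ 2) := by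
      gcongr
      exact integral_norm_batch_four_le hm1 hm hom ho
    have h4 : 2 * η ^ 4 * (75 / m ^ 2) = 150 * (η ^ 2 / m) ^ 2 := by field_simp; ring
    have h5 : η ^ 2 * (φ / d) ≤ (η ^ 2 / m) * Q := by
      calc η ^ 2 * (φ / d) ≤ η ^ 2 * (Q / m) := by
            gcongr
            exact le_add_of_nonneg_right hA
        _ = _ := by ring
    have h6 : 0 ≤ ρ ^ 2 * Q ^ 2 := by positivity
    have h7 : 0 ≤ (η ^ 2 / m) * Q := by positivity
    nlinarith
end Drift

/-! ### The algorithm as a random recursion -/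

section Algorithm

variable {d m : ℕ} {K : Set (EuclideanSpace ℝ (Fin d))} {η γ : ℝ}
  {f : EuclideanSpace ℝ (Fin d) → ℝ}

/-- The point to which one iteration moves from `w` when its directions are `u`. -/
noncomputable def ngdStep (K : Set (EuclideanSpace ℝ (Fin d))) (η γ : ℝ)
    (f : EuclideanSpace ℝ (Fin d) → ℝ) (u : Fin m → EuclideanSpace ℝ (Fin d))
    (w : EuclideanSpace ℝ (Fin d)) : EuclideanSpace ℝ (Fin d) :=
  projOnto K (w - η • ((1 / (m : ℝ)) • ∑ j, signFeedback f (w + γ • u j, w - γ • u j) • u j))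

/-- The winner of the duel `(b, w)`; ties go to `w`. -/
noncomputable def duelWinner (f : EuclideanSpace ℝ (Fin d) → ℝ)
    (b w : EuclideanSpace ℝ (Fin d)) : EuclideanSpace ℝ (Fin d) :=
  if signFeedback f (b, w) < 0 then b else w

theorem duelWinner_le_left (f : EuclideanSpace ℝ (Fin d) → ℝ) (b w : EuclideanSpace ℝ (Fin d)) :
    f (duelWinner f b w) ≤ f b := by
  unfold duelWinner signFeedback
  dsimp only
  split_ifs <;> linarith

theorem duelWinner_le_right (f : EuclideanSpace ℝ (Fin d) → ℝ) (b w : EuclideanSpace ℝ (Fin d)) :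
    f (duelWinner f b w) ≤ f w := by
  unfold duelWinner signFeedback
  dsimp only
  split_ifs <;> linarith

theorem output_batchedNGD_succ (T : ℕ) (u : ℕ → Fin m → EuclideanSpace ℝ (Fin d))
    (w b : EuclideanSpace ℝ (Fin d)) :
    (batchedNGD K η γ (T + 1) u w b).output f =
      (batchedNGD K η γ T (fun i => u (i + 1)) (ngdStep K η γ f (u 0) w)
        (duelWinner f b (ngdStep K η γ f (u 0) w))).output f := rfl

theorem output_batchedNGD_le (T : ℕ) : ∀ (u : ℕ → Fin m → EuclideanSpace ℝ (Fin d))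
    (w b : EuclideanSpace ℝ (Fin d)), f ((batchedNGD K η γ T u w b).output f) ≤ f b := by
  induction T with
  | zero => intro u w b; exact le_rfl
  | succ T ih =>
    intro u w b
    rw [output_batchedNGD_succ]
    exact (ih _ _ _).trans (duelWinner_le_left _ _ _)

theorem batchSizes_batchedNGD (hm : 1 ≤ m) (T : ℕ) :
    ∀ (u : ℕ → Fin m → EuclideanSpace ℝ (Fin d)) (w b : EuclideanSpace ℝ (Fin d)),
      ((batchedNGD K η γ T u w b).batchSizes f).length = 2 * T ∧
        ∀ n ∈ (batchedNGD K η γ T u w b).batchSizes f, n ≤ m := by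
  induction T with
  | zero => intro u w b; simp [batchedNGD, SignProg.batchSizes]
  | succ T ih =>
    intro u w b
    simp only [batchedNGD, SignProg.batchSizes, List.length_cons, List.mem_cons]
    refine ⟨by rw [(ih _ _ _).1]; ring, ?_⟩
    rintro n (rfl | rfl | hn)
    · exact le_rfl
    · exact hm
    · exact (ih _ _ _).2 n hn

theorem Measurable.signFeedback_comp {α : Type*} [MeasurableSpace α] (hf : Measurable f)
    {x y : α → EuclideanSpace ℝ (Fin d)} (hx : Measurable x) (hy : Measurable y) :
    Measurable fun a => signFeedback f (x a, y a) :=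
  Measurable.ite (measurableSet_le measurable_const ((hf.comp hx).sub (hf.comp hy)))
    measurable_const measurable_const

theorem measurable_ngdStep (hK : IsClosed K) (hc : Convex ℝ K) (hne : K.Nonempty)
    (hf : Measurable f) {α : Type*} [MeasurableSpace α]
    {u : α → Fin m → EuclideanSpace ℝ (Fin d)} {w : α → EuclideanSpace ℝ (Fin d)}
    (hu : Measurable u) (hw : Measurable w) :
    Measurable fun a => ngdStep K η γ f (u a) (w a) := by
  have hj : ∀ j, Measurable fun a => u a j := fun j => (measurable_pi_apply j).comp hu
  have h : Measurable fun a => ∑ j,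
      signFeedback f (w a + γ • u a j, w a - γ • u a j) • u a j :=
    Finset.measurable_fun_sum _ fun j _ =>
      (hf.signFeedback_comp (hw.add ((hj j).const_smul γ))
        (hw.sub ((hj j).const_smul γ))).smul (hj j)
  exact (continuous_projOnto hK hc hne).measurable.comp
    (hw.sub ((h.const_smul (1 / (m : ℝ))).const_smul η))

theorem measurable_duelWinner (hf : Measurable f) {α : Type*} [MeasurableSpace α]
    {b w : α → EuclideanSpace ℝ (Fin d)} (hb : Measurable b) (hw : Measurable w) :
    Measurable fun a => duelWinner f (b a) (w a) :=
  Measurable.ite (measurableSet_lt (hf.signFeedback_comp hb hw) measurable_const) hb hw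

theorem measurable_output_batchedNGD (hK : IsClosed K) (hc : Convex ℝ K) (hne : K.Nonempty)
    (hf : Measurable f) {α : Type*} [MeasurableSpace α] (T : ℕ) :
    ∀ {u : α → ℕ → Fin m → EuclideanSpace ℝ (Fin d)} {w b : α → EuclideanSpace ℝ (Fin d)},
      Measurable u → Measurable w → Measurable b →
        Measurable fun a => (batchedNGD K η γ T (u a) (w a) (b a)).output f := by
  induction T with
  | zero => intro u w b _ _ hb; exact hb
  | succ T ih =>
    intro u w b hu hw hb
    simp only [output_batchedNGD_succ]
    have hui : ∀ i, Measurable fun a => u a i := fun i => (measurable_pi_apply i).comp hu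
    have h1 : Measurable fun a => ngdStep K η γ f (u a 0) (w a) :=
      measurable_ngdStep hK hc hne hf (hui 0) hw
    exact ih (u := fun a i => u a (i + 1)) (measurable_pi_lambda _ fun i => hui (i + 1)) h1
      (measurable_duelWinner hf hb h1)

theorem comap_pi_le {α ι E : Type*} [MeasurableSpace E] {M : MeasurableSpace α} {X : ι → α → E}
    (h : ∀ i, MeasurableSpace.comap (X i) inferInstance ≤ M) :
    MeasurableSpace.comap (fun a i => X i a) inferInstance ≤ M :=
  measurable_iff_comap_le.mp (measurable_pi_iff.mpr fun i => measurable_iff_comap_le.mpr (h i))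

/-- `U t j` are measurable, independent and uniform on the sphere. -/
structure IsUniformFamily {Ω : Type*} [MeasurableSpace Ω] (P : Measure Ω)
    (U : ℕ → Fin m → Ω → EuclideanSpace ℝ (Fin d)) : Prop where
  measurable : ∀ t j, Measurable (U t j)
  map_eq : ∀ t j, P.map (U t j) = uniformSphere d
  indep : iIndepFun (fun p : ℕ × Fin m => U p.1 p.2) P

namespace IsUniformFamily

variable {Ω : Type*} [MeasurableSpace Ω] {P : Measure Ω}
  {U : ℕ → Fin m → Ω → EuclideanSpace ℝ (Fin d)}

theorem shift (hU : IsUniformFamily P U) : IsUniformFamily P fun t => U (t + 1) where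
  measurable t j := hU.measurable (t + 1) j
  map_eq t j := hU.map_eq (t + 1) j
  indep := hU.indep.precomp (g := fun p : ℕ × Fin m => (p.1 + 1, p.2)) fun p q h => by
    simpa [Prod.ext_iff] using h

theorem map_zero [IsProbabilityMeasure P] (hU : IsUniformFamily P U) :
    P.map (fun ω j => U 0 j ω) = Measure.pi fun _ => uniformSphere d := by
  have h0 : iIndepFun (fun j : Fin m => U 0 j) P :=
    hU.indep.precomp (g := fun j : Fin m => (0, j)) fun p q h => by simpa using h
  rw [(iIndepFun_iff_map_fun_eq_pi_map fun j => (hU.measurable 0 j).aemeasurable).mp h0]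
  simp [hU.map_eq]

theorem indepFun_zero_shift (hU : IsUniformFamily P U) :
    IndepFun (fun ω j => U 0 j ω) (fun ω t j => U (t + 1) j ω) P := by
  have h := indep_iSup_of_disjoint (S := {p : ℕ × Fin m | p.1 = 0}) (T := {p | p.1 ≠ 0})
    (fun p => (hU.measurable p.1 p.2).comap_le) hU.indep.iIndep
    (Set.disjoint_left.mpr fun p hp hq => hq hp)
  rw [IndepFun_iff_Indep]
  refine indep_of_indep_of_le_left (indep_of_indep_of_le_right h ?_) ?_
  · exact comap_pi_le fun t => comap_pi_le fun j =>
      le_iSup₂_of_le (t + 1, j) (Nat.succ_ne_zero t) le_rfl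
  · exact comap_pi_le fun j => le_iSup₂_of_le (0, j) rfl le_rfl

/-- Averaging over the directions of the first iteration last. -/
theorem integral_eq [IsProbabilityMeasure P] (hd : 1 ≤ d) (hU : IsUniformFamily P U)
    {F : (Fin m → EuclideanSpace ℝ (Fin d)) → (ℕ → Fin m → EuclideanSpace ℝ (Fin d)) → ℝ}
    (hF : Measurable (Function.uncurry F)) {C : ℝ} (hC : ∀ x y, |F x y| ≤ C) :
    Integrable (fun x => ∫ ω, F x (fun t j => U (t + 1) j ω) ∂P)
      (Measure.pi fun _ => uniformSphere d) ∧
    ∫ ω, F (fun j => U 0 j ω) (fun t j => U (t + 1) j ω) ∂P =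
      ∫ x, ∫ ω, F x (fun t j => U (t + 1) j ω) ∂P ∂(Measure.pi fun _ => uniformSphere d) := by
  have := isProbabilityMeasure_uniformSphere hd
  have hX : Measurable fun ω j => U 0 j ω := measurable_pi_lambda _ (hU.measurable 0)
  have hY : Measurable fun ω t j => U (t + 1) j ω :=
    measurable_pi_lambda _ fun t => measurable_pi_lambda _ (hU.measurable (t + 1))
  have hPY : IsProbabilityMeasure (P.map fun ω t j => U (t + 1) j ω) :=
    Measure.isProbabilityMeasure_map hY.aemeasurable
  have hmap := (indepFun_iff_map_prod_eq_prod_map_map hX.aemeasurable hY.aemeasurable).mp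
    hU.indepFun_zero_shift
  rw [hU.map_zero] at hmap
  have hint : Integrable (Function.uncurry F) ((Measure.pi fun _ => uniformSphere d).prod
      (P.map fun ω t j => U (t + 1) j ω)) :=
    Integrable.of_bound hF.aestronglyMeasurable C
      (Filter.Eventually.of_forall fun p => hC p.1 p.2)
  have hin : ∀ x, ∫ y, F x y ∂(P.map fun ω t j => U (t + 1) j ω) =
      ∫ ω, F x (fun t j => U (t + 1) j ω) ∂P := fun x =>
    integral_map hY.aemeasurable (hF.comp measurable_prodMk_left).aestronglyMeasurable
  refine ⟨hint.integral_prod_left.congr (Filter.Eventually.of_forall hin), ?_⟩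
  have h1 := integral_map (hX.prodMk hY).aemeasurable (μ := P) hF.aestronglyMeasurable
  rw [hmap, integral_prod _ hint] at h1
  simp only [Function.uncurry] at h1
  rw [← h1]
  exact integral_congr_ae (Filter.Eventually.of_forall hin)

end IsUniformFamily

/-- The bound for the mean square of the potential after `n` iterations that start from potential
`Q`; here `ρ` is the relative error of the drift and `l = η² / m`. -/
def potentialBound (ρ l : ℝ) (n : ℕ) (Q : ℝ) : ℝ :=
  ((1 + ρ) ^ 2) ^ n * (Q ^ 2 + 34 * l * n * Q + (102 * l ^ 2 * n ^ 2 + 150 * l ^ 2 * n))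

/-- Second moment bound for the best value `M` found in `n` iterations. As long as the current value
exceeds the threshold `θ`, the drift `a √Δ` of the potential is at least `a √M`, and it is
accumulated in `A`. -/
theorem integral_output_le {a θ ρ : ℝ} {z : EuclideanSpace ℝ (Fin d)} (hm1 : 1 ≤ m) (hm : m ≤ d)
    (hK : IsClosed K) (hKc : Convex ℝ K) (hzK : z ∈ K) (hf : Measurable f)
    (ha : 0 ≤ a) (hρ : 0 ≤ ρ) (hθ : 0 ≤ θ)
    (hdrift : ∀ w, θ < f w - f z → a * √(f w - f z) ≤
      2 * η * ∫ u, inner ℝ (signFeedback f (w + γ • u, w - γ • u) • u) (w - z) ∂uniformSphere d +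
        ρ * ‖w - z‖ ^ 2)
    (hquad : ∀ w, (a * √(f w - f z)) ^ 2 ≤ 4 / 3 * (η ^ 2 * (‖w - z‖ ^ 2 / d)))
    {Ω : Type*} [MeasurableSpace Ω] {P : Measure Ω} [IsProbabilityMeasure P] (n : ℕ) :
    ∀ (U : ℕ → Fin m → Ω → EuclideanSpace ℝ (Fin d)), IsUniformFamily P U →
      ∀ (w b : EuclideanSpace ℝ (Fin d)), f b ≤ f w → ∀ A : ℝ, 0 ≤ A →
      ∫ ω, (A + a * n * √(f ((batchedNGD K η γ n (fun t j => U t j ω) w b).output f) - f z - θ)) ^ 2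
        ∂P ≤ potentialBound ρ (η ^ 2 / m) n (‖w - z‖ ^ 2 + A) := by
  have hl : 0 ≤ η ^ 2 / (m : ℝ) := by positivity
  induction n with
  | zero =>
    intro U hU w b hb A hA
    simp only [Nat.cast_zero, mul_zero, zero_mul, add_zero, integral_const, probReal_univ,
      smul_eq_mul, one_mul, potentialBound, pow_zero]
    norm_num
    gcongr
    exact le_add_of_nonneg_left (by positivity)
  | succ n ih =>
    intro U hU w b hb A hA
    have hd : 1 ≤ d := hm1.trans hm
    have hprob := isProbabilityMeasure_uniformSphere hd
    have hr : 1 ≤ (1 + ρ) ^ 2 := one_le_pow₀ (by linarith)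
    set Q := ‖w - z‖ ^ 2 + A with hQ
    have hQ0 : 0 ≤ Q := by positivity
    by_cases hw : f w - f z ≤ θ
    · -- Below the threshold the output is below it too, and the square root vanishes.
      have h0 : ∀ ω, √(f ((batchedNGD K η γ (n + 1) (fun t j => U t j ω) w b).output f) -
          f z - θ) = 0 := fun ω => Real.sqrt_eq_zero_of_nonpos (by
        linarith [output_batchedNGD_le (K := K) (η := η) (γ := γ) (f := f) (n + 1)
          (fun t j => U t j ω) w b])
      simp only [h0, mul_zero, add_zero, integral_const, probReal_univ, smul_eq_mul, one_mul]
      have h1 : A ^ 2 ≤ Q ^ 2 := by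
        gcongr
        exact le_add_of_nonneg_left (by positivity)
      unfold potentialBound
      calc A ^ 2 ≤ 1 * (Q ^ 2 + 0) := by linarith
        _ ≤ _ := by
          rw [add_assoc]
          gcongr
          · exact one_le_pow₀ hr
          · positivity
    · push Not at hw
      set δ := a * √(f w - f z) with hδ
      have hδ0 : 0 ≤ δ := by positivity
      set o : EuclideanSpace ℝ (Fin d) → ℝ := fun u => signFeedback f (w + γ • u, w - γ • u)
      have hom : Measurable o := hf.signFeedback_comp (by fun_prop) (by fun_prop)
      obtain ⟨hi1, hi2, hE1, hE2⟩ := integral_potential_step_le (m := m) (o := o) hm1 hm hK hKc hzK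
        hom (fun u => signFeedback_sq _ _) hA hδ0 hρ (hdrift w hw) (hquad w)
      set Q' : (Fin m → EuclideanSpace ℝ (Fin d)) → ℝ := fun u =>
        ‖projOnto K (w - η • ((1 / (m : ℝ)) • ∑ j, o (u j) • u j)) - z‖ ^ 2 + (A + δ) with hQ'
      let out : (Fin m → EuclideanSpace ℝ (Fin d)) → (ℕ → Fin m → EuclideanSpace ℝ (Fin d)) →
          EuclideanSpace ℝ (Fin d) := fun x y =>
        (batchedNGD K η γ n y (ngdStep K η γ f x w)
          (duelWinner f b (ngdStep K η γ f x w))).output f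
      let F : (Fin m → EuclideanSpace ℝ (Fin d)) → (ℕ → Fin m → EuclideanSpace ℝ (Fin d)) → ℝ :=
        fun x y => ((A + δ) + a * n * √(f (out x y) - f z - θ)) ^ 2
      have hout : ∀ x y, f (out x y) ≤ f b := fun x y =>
        (output_batchedNGD_le _ _ _ _).trans (duelWinner_le_left _ _ _)
      have hFm : Measurable (Function.uncurry F) := by
        have h1 : Measurable fun p : (Fin m → EuclideanSpace ℝ (Fin d)) ×
            (ℕ → Fin m → EuclideanSpace ℝ (Fin d)) => ngdStep K η γ f p.1 w :=
          measurable_ngdStep hK hKc ⟨z, hzK⟩ hf measurable_fst measurable_const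
        have h3 : Measurable (Function.uncurry out) :=
          measurable_output_batchedNGD hK hKc ⟨z, hzK⟩ hf n measurable_snd h1
            (measurable_duelWinner hf measurable_const h1)
        exact (((((hf.comp h3).sub_const (f z)).sub_const θ).sqrt.const_mul
          (a * n)).const_add (A + δ)).pow_const 2
      have hFC : ∀ x y, |F x y| ≤ ((A + δ) + a * n * √(f b - f z - θ)) ^ 2 := by
        intro x y
        rw [abs_of_nonneg (sq_nonneg _)]
        have := hout x y
        change ((A + δ) + a * n * √(f (out x y) - f z - θ)) ^ 2 ≤ _
        gcongr
      obtain ⟨hFi, hFe⟩ := hU.integral_eq hd hFm hFC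
      have hXY : Measurable fun ω => ((fun j => U 0 j ω), fun t j => U (t + 1) j ω) :=
        (measurable_pi_lambda _ (hU.measurable 0)).prodMk
          (measurable_pi_lambda _ fun t => measurable_pi_lambda _ (hU.measurable (t + 1)))
      -- The decrement of this iteration is at least `a` times the square root of the final excess.
      have hle : ∀ ω, (A + a * (n + 1 : ℕ) * √(f ((batchedNGD K η γ (n + 1)
          (fun t j => U t j ω) w b).output f) - f z - θ)) ^ 2 ≤
          F (fun j => U 0 j ω) (fun t j => U (t + 1) j ω) := by
        intro ω
        rw [output_batchedNGD_succ]
        change _ ≤ ((A + δ) + a * n * √(f (out _ _) - f z - θ)) ^ 2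
        change (A + a * (n + 1 : ℕ) * √(f (out (fun j => U 0 j ω) fun t j => U (t + 1) j ω) -
          f z - θ)) ^ 2 ≤ _
        have h1 : √(f (out (fun j => U 0 j ω) fun t j => U (t + 1) j ω) - f z - θ) ≤
            √(f w - f z) := Real.sqrt_le_sqrt (by
          linarith [hout (fun j => U 0 j ω) fun t j => U (t + 1) j ω])
        have h2 := mul_le_mul_of_nonneg_left h1 ha
        refine pow_le_pow_left₀ (by positivity) ?_ 2
        push_cast
        linarith
      have hFint : Integrable
          (fun ω => F (fun j => U 0 j ω) (fun t j => U (t + 1) j ω)) P :=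
        Integrable.of_bound (hFm.comp hXY).aestronglyMeasurable _
          (Filter.Eventually.of_forall fun ω => hFC _ _)
      calc _ ≤ ∫ ω, F (fun j => U 0 j ω) (fun t j => U (t + 1) j ω) ∂P :=
            integral_mono_of_nonneg (Filter.Eventually.of_forall fun ω => sq_nonneg _) hFint
              (Filter.Eventually.of_forall hle)
        _ = ∫ x, ∫ ω, F x (fun t j => U (t + 1) j ω) ∂P ∂(Measure.pi fun _ => uniformSphere d) :=
            hFe
        _ ≤ ∫ x, potentialBound ρ (η ^ 2 / m) n (Q' x) ∂(Measure.pi fun _ => uniformSphere d) := by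
            refine integral_mono hFi ?_ fun x => ?_
            · exact ((hi2.add (hi1.const_mul _)).add (integrable_const _)).const_mul _
            · exact ih _ hU.shift _ _ (duelWinner_le_right _ _ _) (A + δ) (by positivity)
        _ = ((1 + ρ) ^ 2) ^ n * (∫ x, Q' x ^ 2 ∂(Measure.pi fun _ => uniformSphere d) +
              34 * (η ^ 2 / m) * n * ∫ x, Q' x ∂(Measure.pi fun _ => uniformSphere d) +
              (102 * (η ^ 2 / m) ^ 2 * n ^ 2 + 150 * (η ^ 2 / m) ^ 2 * n)) := by
            have h1 : Integrable (fun x => Q' x ^ 2 + 34 * (η ^ 2 / m) * n * Q' x)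
              (Measure.pi fun _ => uniformSphere d) := hi2.add (hi1.const_mul _)
            unfold potentialBound
            rw [integral_const_mul, integral_add h1 (integrable_const _),
              integral_add hi2 (hi1.const_mul _), integral_const_mul]
            simp
        _ ≤ ((1 + ρ) ^ 2) ^ n * (((1 + ρ) ^ 2 * Q ^ 2 + 34 * (η ^ 2 / m) * Q +
              150 * (η ^ 2 / m) ^ 2) +
              34 * (η ^ 2 / m) * n * ((1 + ρ) * Q + 6 * (η ^ 2 / m)) +
              (102 * (η ^ 2 / m) ^ 2 * n ^ 2 + 150 * (η ^ 2 / m) ^ 2 * n)) := by gcongr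
        _ ≤ ((1 + ρ) ^ 2) ^ n * ((1 + ρ) ^ 2 * (Q ^ 2 + 34 * (η ^ 2 / m) * (n + 1 : ℕ) * Q +
              (102 * (η ^ 2 / m) ^ 2 * (n + 1 : ℕ) ^ 2 + 150 * (η ^ 2 / m) ^ 2 * (n + 1 : ℕ)))) := by
            refine mul_le_mul_of_nonneg_left ?_ (by positivity)
            generalize η ^ 2 / (m : ℝ) = l at hl
            push_cast
            have h1 : 0 ≤ (2 * ρ + ρ ^ 2) * (34 * l * Q) := by positivity
            have h2 : 0 ≤ (ρ + ρ ^ 2) * (34 * l * n * Q) := by positivity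
            have h3 : 0 ≤ (2 * ρ + ρ ^ 2) *
              (102 * l ^ 2 * (n + 1) ^ 2 + 150 * l ^ 2 * (n + 1)) := by positivity
            nlinarith [sq_nonneg l]
        _ = potentialBound ρ (η ^ 2 / m) (n + 1) Q := by
            unfold potentialBound
            rw [pow_succ ((1 + ρ) ^ 2)]; ring

end Algorithm

/-! ### The prescribed parameters -/

section Parameters

variable {d m : ℕ} {β D ε : ℝ}

theorem learningRate_sq_div (hm : 1 ≤ m) (hd : 1 ≤ d) (hβ : 0 < β) (hε : 0 < ε) :
    learningRate d m β ε ^ 2 / m = m * ε / (400 * (d * β)) := by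
  have hm0 : (0 : ℝ) < m := by positivity
  have hd0 : (0 : ℝ) < d := by positivity
  rw [learningRate, div_pow, mul_pow, mul_pow, Real.sq_sqrt hε.le, Real.sq_sqrt (by positivity)]
  field_simp
  norm_num

theorem perturbation_pos (hd : 1 ≤ d) (hβ : 0 < β) (hD : 0 < D) (hε : 0 < ε) :
    0 < perturbation d β D ε := by
  have hd0 : (0 : ℝ) < d := by positivity
  have : 0 < Real.log 480 := Real.log_pos (by norm_num)
  have : 0 < max D (D ^ 2) := lt_max_of_lt_left hD
  unfold perturbation
  positivity

theorem perturbation_le (hd : 1 ≤ d) (hβ : 0 < β) (hD : 0 < D) (hε : 0 < ε) :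
    perturbation d β D ε ≤ ε * √ε / (960 * β * d * √d * D * 2) * (√2 / √β) := by
  have hd0 : (0 : ℝ) < d := by positivity
  have h1 : (2 : ℝ) ≤ √(Real.log 480) := by
    apply Real.le_sqrt_of_sq_le
    rw [Real.le_log_iff_exp_le (by norm_num)]
    have : Real.exp (2 ^ 2) = Real.exp 1 ^ 4 := by rw [← Real.exp_nat_mul]; norm_num
    rw [this]
    calc Real.exp 1 ^ 4 ≤ (3 : ℝ) ^ 4 := by
          gcongr
          linarith [Real.exp_one_lt_d9]
      _ ≤ 480 := by norm_num
  have h2 : ε ^ (3 / 2 : ℝ) = ε * √ε := by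
    rw [show (3 / 2 : ℝ) = 1 + 1 / 2 by norm_num, Real.rpow_add hε, Real.rpow_one,
      Real.sqrt_eq_rpow]
  rw [perturbation, h2, Real.sqrt_div (by norm_num)]
  gcongr
  exact le_max_left _ _

/-- Over the whole run the wrong signs contribute a relative error of at most `0.121`. -/
theorem drift_error_le (hm : 1 ≤ m) (hd : 1 ≤ d) (hβ : 0 < β) (hD : 0 < D) (hε : 0 < ε) :
    100 * (d * β * D / (m * ε)) *
      (12 * Real.exp 1 * learningRate d m β ε * d * β * perturbation d β D ε / ε) ≤ 0.121 := by
  have hm0 : (0 : ℝ) < m := by positivity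
  have hd0 : (0 : ℝ) < d := by positivity
  have hsd : 0 < √(d : ℝ) := Real.sqrt_pos.mpr hd0
  have hsβ : 0 < √β := Real.sqrt_pos.mpr hβ
  have hsε : 0 < √ε := Real.sqrt_pos.mpr hε
  have hη : 0 ≤ learningRate d m β ε := by unfold learningRate; positivity
  calc _ ≤ 100 * (d * β * D / (m * ε)) *
        (12 * Real.exp 1 * learningRate d m β ε * d * β *
          (ε * √ε / (960 * β * d * √d * D * 2) * (√2 / √β)) / ε) := by
        gcongr
        exact perturbation_le hd hβ hD hε
    _ = Real.exp 1 * √2 / 32 := by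
        rw [learningRate, Real.sqrt_mul hd0.le]
        have h1 : (d : ℝ) = √d ^ 2 := (Real.sq_sqrt hd0.le).symm
        have h2 : β = √β ^ 2 := (Real.sq_sqrt hβ.le).symm
        have h3 : ε = √ε ^ 2 := (Real.sq_sqrt hε.le).symm
        generalize √(d : ℝ) = x at *
        generalize √β = y at *
        generalize √ε = w at *
        rw [h1, h2, h3]
        field_simp
        norm_num
    _ ≤ 2.7183 * 1.4143 / 32 := by
        gcongr
        · linarith [Real.exp_one_lt_d9]
        · rw [Real.sqrt_le_left (by norm_num)]; norm_num
    _ ≤ 0.121 := by norm_num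

/-- Numerical value of the bound on the potential at the end of a run. -/
theorem potentialBound_le {ρ l Q : ℝ} {T : ℕ} (hρ : 0 ≤ ρ) (hl : 0 ≤ l) (hQ : 0 ≤ Q) (hD : 0 < D)
    (hTρ : T * ρ ≤ 0.121) (hTl : T * l ≤ D / 4) (hlD : l ≤ D / 800) (hQD : Q ≤ D) :
    potentialBound ρ l T Q ≤ 21 * D ^ 2 := by
  have h1 : ((1 + ρ) ^ 2) ^ T ≤ 1.3 := by
    calc ((1 + ρ) ^ 2) ^ T ≤ (Real.exp ρ ^ 2) ^ T := by
          gcongr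
          linarith [Real.add_one_le_exp ρ]
      _ = Real.exp (2 * (T * ρ)) := by
          rw [← Real.exp_nat_mul, ← Real.exp_nat_mul]; congr 1; push_cast; ring
      _ ≤ Real.exp (1 / 4) := by
          gcongr; linarith
      _ ≤ 1.3 := by
          have h : Real.exp (1 / 4) ^ 4 = Real.exp 1 := by rw [← Real.exp_nat_mul]; norm_num
          refine le_of_pow_le_pow_left₀ (n := 4) (by norm_num) (by norm_num) ?_
          rw [h]
          linarith [Real.exp_one_lt_d9]
  have h2 : Q ^ 2 ≤ D ^ 2 := by gcongr
  have h3 : 34 * l * T * Q ≤ 34 * (D / 4) * D := by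
    calc 34 * l * T * Q = 34 * (T * l) * Q := by ring
      _ ≤ _ := by gcongr
  have h4 : 102 * l ^ 2 * T ^ 2 ≤ 102 * (D / 4) ^ 2 := by
    calc 102 * l ^ 2 * T ^ 2 = 102 * (T * l) ^ 2 := by ring
      _ ≤ _ := by gcongr
  have h5 : 150 * l ^ 2 * T ≤ 150 * (D / 800) * (D / 4) := by
    calc 150 * l ^ 2 * T = 150 * l * (T * l) := by ring
      _ ≤ _ := by gcongr
  unfold potentialBound
  calc _ ≤ 1.3 * (D ^ 2 + 34 * (D / 4) * D + (102 * (D / 4) ^ 2 + 150 * (D / 800) * (D / 4))) := by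
        gcongr
    _ ≤ 21 * D ^ 2 := by nlinarith [sq_nonneg D]

end Parameters

/-! ### Convergence -/

section Convergence

variable {d m : ℕ} {β D ε : ℝ} {K : Set (EuclideanSpace ℝ (Fin d))}
  {f : EuclideanSpace ℝ (Fin d) → ℝ} {z w : EuclideanSpace ℝ (Fin d)}
  {Ω : Type*} [MeasurableSpace Ω] {P : Measure Ω} [IsProbabilityMeasure P]
  {U : ℕ → Fin m → Ω → EuclideanSpace ℝ (Fin d)}

/-- Convergence in the nontrivial regime, in which `ε` is below the worst possible initial
suboptimality `β D / 2`. -/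
theorem integral_output_sub_le (hm1 : 1 ≤ m) (hm : m ≤ d) (hβ : 0 < β) (hD : 0 < D) (hε : 0 < ε)
    (hK : IsClosed K) (hKc : Convex ℝ K) (hc : ConvexOn ℝ Set.univ f) (hf : IsSmoothFn β f)
    (hzK : z ∈ K) (hz : ∀ x, f z ≤ f x) (hw : ‖w - z‖ ^ 2 ≤ D) (hεD : ε ≤ β * D / 2)
    (hU : IsUniformFamily P U) {T : ℕ} (hT : T = ⌊100 * (d * β * D / (m * ε))⌋₊)
    (hint : Integrable (fun ω => f ((batchedNGD K (learningRate d m β ε) (perturbation d β D ε) T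
      (fun t j => U t j ω) w w).output f)) P) :
    ∫ ω, f ((batchedNGD K (learningRate d m β ε) (perturbation d β D ε) T
      (fun t j => U t j ω) w w).output f) ∂P - f z ≤ ε := by
  have hd : 1 ≤ d := hm1.trans hm
  have hm0 : (0 : ℝ) < m := by positivity
  have hd0 : (0 : ℝ) < d := by positivity
  have hmd : (m : ℝ) ≤ d := by exact_mod_cast hm
  have hηl := learningRate_sq_div hm1 hd hβ hε
  have hγ := perturbation_pos hd hβ hD hε
  have hρT := drift_error_le hm1 hd hβ hD hε
  have hη : 0 ≤ learningRate d m β ε := by unfold learningRate; positivity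
  set η := learningRate d m β ε with hη_def
  set γ := perturbation d β D ε with hγ_def
  set N := d * β * D / (m * ε) with hN
  set ρ := 12 * Real.exp 1 * η * d * β * γ / ε with hρ_def
  -- `a √Δ` is `2 η` times the main term of the mean drift at suboptimality `Δ`.
  set a := 2 * η * (√(2 / β) / √(3 * d)) with ha_def
  have hρ : 0 ≤ ρ := by positivity
  have ha : 0 ≤ a := by positivity
  have hN1 : 1 ≤ N := by
    rw [hN, one_le_div (by positivity)]
    have : m * ε ≤ d * (β * D / 2) := by gcongr
    have : 0 < d * β * D := by positivity
    linarith
  have hTle : (T : ℝ) ≤ 100 * N := by rw [hT]; exact Nat.floor_le (by positivity)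
  have hTge : 99 * N ≤ T := by
    have := Nat.lt_floor_add_one (100 * N)
    rw [← hT] at this
    linarith
  have ha2 : a ^ 2 = 8 * η ^ 2 / (3 * (β * d)) := by
    rw [ha_def, mul_pow, div_pow, Real.sq_sqrt (by positivity), Real.sq_sqrt (by positivity)]
    field_simp
    ring
  have hsplit : ∀ x : ℝ, √(2 * x / β) = √(2 / β) * √x := fun x => by
    rw [← Real.sqrt_mul (by positivity)]; congr 1; ring
  have hdrift : ∀ x, ε / 2 < f x - f z → a * √(f x - f z) ≤
      2 * η * ∫ u, inner ℝ (signFeedback f (x + γ • u, x - γ • u) • u) (x - z) ∂uniformSphere d +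
        ρ * ‖x - z‖ ^ 2 := by
    intro x hx
    have h1 := mul_le_mul_of_nonneg_left
      (le_integral_inner_signed (w := x) hd hβ hγ hc hf hz (by linarith))
      (by positivity : 0 ≤ 2 * η)
    rw [hsplit] at h1
    have h2 : 2 * η * (3 * Real.exp 1 * d * β * γ * ‖x - z‖ ^ 2 / (f x - f z)) ≤
        2 * η * (3 * Real.exp 1 * d * β * γ * ‖x - z‖ ^ 2 / (ε / 2)) := by gcongr
    have h3 : 2 * η * (3 * Real.exp 1 * d * β * γ * ‖x - z‖ ^ 2 / (ε / 2)) =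
        ρ * ‖x - z‖ ^ 2 := by rw [hρ_def]; field_simp; ring
    have h4 : a * √(f x - f z) = 2 * η * (√(2 / β) * √(f x - f z) / √(3 * d)) := by
      rw [ha_def]; ring
    rw [h4]
    linarith
  have hquad : ∀ x, (a * √(f x - f z)) ^ 2 ≤ 4 / 3 * (η ^ 2 * (‖x - z‖ ^ 2 / d)) := by
    intro x
    rw [mul_pow, ha2, Real.sq_sqrt (by linarith [hz x])]
    calc 8 * η ^ 2 / (3 * (β * d)) * (f x - f z)
        ≤ 8 * η ^ 2 / (3 * (β * d)) * (β / 2 * ‖x - z‖ ^ 2) := by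
          gcongr
          exact hf.sub_le_of_forall_le hz x
      _ = _ := by field_simp; ring
  have hmain := integral_output_le (a := a) (θ := ε / 2) (ρ := ρ) (η := η) (γ := γ) hm1 hm hK hKc
    hzK hf.1.continuous.measurable ha hρ (by positivity) hdrift hquad T U hU w w le_rfl 0 le_rfl
  have hl : 0 ≤ η ^ 2 / (m : ℝ) := by positivity
  have hTl : T * (η ^ 2 / (m : ℝ)) ≤ D / 4 := by
    calc T * (η ^ 2 / (m : ℝ)) ≤ 100 * N * (η ^ 2 / (m : ℝ)) := by gcongr
      _ = D / 4 := by rw [hηl, hN]; field_simp; norm_num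
  have hlD : η ^ 2 / (m : ℝ) ≤ D / 800 := by
    rw [hηl, div_le_iff₀ (by positivity)]
    have : m * ε ≤ d * (β * D / 2) := by gcongr
    linarith
  have hTρ : T * ρ ≤ 0.121 := (mul_le_mul_of_nonneg_right hTle hρ).trans hρT
  have hpot := hmain.trans (potentialBound_le hρ hl (by positivity) hD hTρ hTl hlD
    (by simpa using hw))
  set M : Ω → ℝ := fun ω => f ((batchedNGD K η γ T (fun t j => U t j ω) w w).output f)
  have hMw : ∀ ω, M ω ≤ f w := fun ω => output_batchedNGD_le _ _ _ _
  have hiZ : Integrable (fun ω => √(M ω - f z - ε / 2) ^ 2) P := by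
    refine Integrable.of_bound (((hint.aemeasurable.sub_const _).sub_const _).sqrt.pow_const
      2).aestronglyMeasurable (√(f w - f z - ε / 2) ^ 2) (Filter.Eventually.of_forall fun ω => ?_)
    rw [Real.norm_of_nonneg (sq_nonneg _)]
    have := hMw ω
    gcongr
  have hZ : ∫ ω, √(M ω - f z - ε / 2) ^ 2 ∂P ≤ ε / 2 := by
    have h1 : ∀ ω, (0 + a * T * √(M ω - f z - ε / 2)) ^ 2 =
        (a * T) ^ 2 * √(M ω - f z - ε / 2) ^ 2 := fun ω => by ring
    have h2 : (a * T) ^ 2 * ∫ ω, √(M ω - f z - ε / 2) ^ 2 ∂P ≤ 21 * D ^ 2 := by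
      rw [← integral_const_mul]
      simpa only [M, ← h1] using hpot
    have h3 : 65 * D ^ 2 / ε ≤ (a * T) ^ 2 := by
      have hη2 : η ^ 2 = m * (m * ε / (400 * (d * β))) := by rw [← hηl]; field_simp
      calc 65 * D ^ 2 / ε ≤ 99 ^ 2 / 150 * D ^ 2 / ε := by gcongr; norm_num
        _ = a ^ 2 * (99 * N) ^ 2 := by rw [ha2, hη2, hN]; field_simp; norm_num
        _ ≤ a ^ 2 * T ^ 2 := by gcongr
        _ = _ := by ring
    have h4 : 0 ≤ ∫ ω, √(M ω - f z - ε / 2) ^ 2 ∂P := integral_nonneg fun ω => sq_nonneg _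
    have h5 := (mul_le_mul_of_nonneg_right h3 h4).trans h2
    rw [div_mul_eq_mul_div, div_le_iff₀ hε] at h5
    have hD2 : 0 < D ^ 2 := by positivity
    have h6 : D ^ 2 * (65 * ∫ ω, √(M ω - f z - ε / 2) ^ 2 ∂P) ≤ D ^ 2 * (21 * ε) := by linarith
    have := le_of_mul_le_mul_left h6 hD2
    linarith
  -- `√x ^ 2` is the positive part of `x`.
  have hle : ∀ ω, M ω ≤ √(M ω - f z - ε / 2) ^ 2 + (f z + ε / 2) := by
    intro ω
    rcases le_total 0 (M ω - f z - ε / 2) with h | h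
    · rw [Real.sq_sqrt h]; linarith
    · rw [Real.sqrt_eq_zero_of_nonpos h]; linarith
  have hfin := integral_mono hint (hiZ.add (integrable_const _)) hle
  rw [integral_add' hiZ (integrable_const _)] at hfin
  simp only [integral_const, probReal_univ, smul_eq_mul, one_mul] at hfin
  change ∫ ω, M ω ∂P - f z ≤ ε
  linarith

end Convergence

theorem mainTheorem1 :
    ∃ C : ℝ, 0 < C ∧
      ∀ (d m : ℕ) (_ : 1 ≤ m) (_ : m ≤ d) (β D ε : ℝ) (_ : 0 < β) (_ : 0 < D) (_ : 0 < ε)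
        (K : Set (EuclideanSpace ℝ (Fin d))) (_ : Convex ℝ K) (_ : IsClosed K)
        (f : EuclideanSpace ℝ (Fin d) → ℝ) (_ : ConvexOn ℝ Set.univ f) (_ : IsSmoothFn β f)
        (xstar : EuclideanSpace ℝ (Fin d)) (_ : xstar ∈ K) (_ : ∀ x, f xstar ≤ f x)
        (w₁ : EuclideanSpace ℝ (Fin d)) (_ : w₁ ∈ K) (_ : ‖w₁ - xstar‖ ^ 2 ≤ D)
        (Ω : Type*) (_ : MeasurableSpace Ω) (P : Measure Ω) (_ : IsProbabilityMeasure P)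
        (U : ℕ → Fin m → Ω → EuclideanSpace ℝ (Fin d))
        (_ : ∀ t j, HasLaw (U t j) (uniformSphere d) P)
        (_ : iIndepFun (fun p : ℕ × Fin m => U p.1 p.2) P),
        let T : ℕ := ⌊C * (d * β * D / (m * ε))⌋₊
        let alg : Ω → SignProg (EuclideanSpace ℝ (Fin d)) := fun ω =>
          batchedNGD K (learningRate d m β ε) (perturbation d β D ε) T (fun t j => U t j ω) w₁ w₁
        (Integrable (fun ω => f ((alg ω).output f)) P ∧
          (∫ ω, f ((alg ω).output f) ∂P) - f xstar ≤ ε) ∧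
        ∀ ω, ((alg ω).batchSizes f).length = 2 * T ∧ ∀ n ∈ (alg ω).batchSizes f, n ≤ m := by
  refine ⟨100, by norm_num, ?_⟩
  intro d m hm1 hm β D ε hβ hD hε K hKc hK f hc hf xstar hxK hx w₁ _ hw Ω _ P _ U hU hI T alg
  refine ⟨?_, fun ω => batchSizes_batchedNGD hm1 _ _ _ _⟩
  have hfm : Measurable f := hf.1.continuous.measurable
  -- The directions agree almost surely with measurable ones.
  let V : ℕ → Fin m → Ω → EuclideanSpace ℝ (Fin d) := fun t j => (hU t j).aemeasurable.mk (U t j)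
  have hVU : ∀ᵐ ω ∂P, ∀ t j, U t j ω = V t j ω :=
    ae_all_iff.mpr fun t => ae_all_iff.mpr fun j => (hU t j).aemeasurable.ae_eq_mk
  have hV : IsUniformFamily P V :=
    { measurable := fun t j => (hU t j).aemeasurable.measurable_mk
      map_eq := fun t j => by
        rw [← (hU t j).map_eq]
        exact Measure.map_congr (hU t j).aemeasurable.ae_eq_mk.symm
      indep := hI.congr fun p => (hU p.1 p.2).aemeasurable.ae_eq_mk }
  have hout : (fun ω => f ((alg ω).output f)) =ᵐ[P] fun ω => f ((batchedNGD K
      (learningRate d m β ε) (perturbation d β D ε) T (fun t j => V t j ω) w₁ w₁).output f) := by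
    filter_upwards [hVU] with ω hω
    simp only [alg, hω]
  have hVm : Measurable fun ω t j => V t j ω :=
    measurable_pi_lambda _ fun t => measurable_pi_lambda _ (hV.measurable t)
  have hint : Integrable (fun ω => f ((batchedNGD K
      (learningRate d m β ε) (perturbation d β D ε) T (fun t j => V t j ω) w₁ w₁).output f)) P := by
    refine Integrable.of_bound (hfm.comp (measurable_output_batchedNGD hK hKc ⟨xstar, hxK⟩ hfm T
      hVm measurable_const measurable_const)).aestronglyMeasurable (max |f xstar| |f w₁|)
      (Filter.Eventually.of_forall fun ω => ?_)
    exact abs_le_max_abs_abs (hx _) (output_batchedNGD_le _ _ _ _)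
  refine ⟨hint.congr hout.symm, ?_⟩
  rw [integral_congr_ae hout]
  rcases le_total ε (β * D / 2) with h | h
  · exact integral_output_sub_le hm1 hm hβ hD hε hK hKc hc hf hxK hx hw h hV rfl hint
  · have h1 := integral_mono hint (integrable_const (f w₁)) fun ω => output_batchedNGD_le _ _ _ _
    simp only [integral_const, probReal_univ, smul_eq_mul, one_mul] at h1
    have h2 := hf.sub_le_of_forall_le hx w₁
    have h3 : β / 2 * ‖w₁ - xstar‖ ^ 2 ≤ β / 2 * D := by gcongr
    linarith
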